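/- Let $N\ge 1$ be an integer, $0<\theta\le 2$ and $0<\gamma<\min\{\theta,N\}$. Let $p>p_\gamma:=1+\frac{\theta-\gamma}{N}$, and if $\theta<2$ assume also $\gamma<\theta(p-1)$. Consider the Cauchy problem $$\partial_t u+(-\Delta)^{\theta/2}u=|x|^{-\gamma}u^p\quad (x\in\mathbb R^N,\ t>0),\qquad u(0)=\mu .\tag{P}$$ Let $G$ be the fundamental solution of $\partial_t v+(-\Delta)^{\theta/2}v=0$ in $\mathbb R^N\times(0,\infty)$, i.e. $G(x,t)=(2\pi)^{-N}\int_{\mathbb R^N}e^{i x\cdot\xi}e^{-t|\xi|^\theta}\,d\xi$. For a nonnegative measure $\mu$ on $\mathbb R^N$ and $0<T\le\infty$, a nonnegative measurable function $u$ on $\mathbb R^N\times(0,T)$ is a solution of (P) in $\mathbb R^N\times[0,T)$ if, for all $0<t<T$ and almost all $x\in\mathbb R^N$, $$\infty>u(x,t)=\int_{\mathbb R^N}G(x-y,t)\,d\mu(y)+\int_0^t\int_{\mathbb R^N}G(x-y,t-s)\,|y|^{-\gamma}u(y,s)^p\,dy\,ds .$$ A local-in-time solution is a solution in $\mathbb R^N\times[0,T)$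 for some $T>0$. A nonnegative measurable function $\mu$ is identified with the measure $\mu(x)\,dx$. (i) There exists a constant $c_*>0$, depending only on $N,\theta,\gamma,p$, such that if $\mu$ is a measurable function with $$0\le\mu(x)\le c_*|x|^{-\frac{\theta-\gamma}{p-1}}\quad\text{for almost all }x\in\mathbb R^N,$$ then (P) possesses a local-in-time solution. (ii) The singularity in (i) is optimal at the origin: there exists a constant $C_*>0$, depending only on $N,\theta,\gamma,p$, such that if $\mu$ is a nonnegative measurable function with $\mu(x)\ge C_*|x|^{-\frac{\theta-\gamma}{p-1}}$ for almost all $x$ in a neighbourhood of the origin, then (P) possesses no local-in-time solution. -/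

import Mathlib

open MeasureTheory Set
open scoped FourierTransform ENNReal

namespace HardyParabolic

/-- The fundamental solution `G(x,t)` of `∂ₜ v + (-Δ)^(θ/2) v = 0` in `ℝᴺ × (0,∞)`.  The operator
`(-Δ)^(θ/2)` is the Fourier multiplier with symbol `(2π|ξ|)^θ` for Mathlib's normalisation
`𝓕 v (ξ) = ∫ exp(-2πi⟨x,ξ⟩) v(x) dx`, so `G(·,t)` is the inverse Fourier transform of
`ξ ↦ exp(-t (2π|ξ|)^θ)`.  The transformed function is even, hence its inverse Fourier transform is
real and taking the real part loses nothing. -/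
noncomputable def G (N : ℕ) (θ : ℝ) (x : EuclideanSpace ℝ (Fin N)) (t : ℝ) : ℝ :=
  (𝓕⁻ (fun ξ : EuclideanSpace ℝ (Fin N) =>
    ((Real.exp (-t * (2 * Real.pi * ‖ξ‖) ^ θ) : ℝ) : ℂ)) x).re

/-- `u` is a solution in `ℝᴺ × [0,T)`, `0 < T ≤ ∞`, of
`∂ₜ u + (-Δ)^(θ/2) u = |x|^(-γ) u^p`, `u(0) = μ`: it is a nonnegative (Lebesgue) measurable function
on `ℝᴺ × (0,T)` with
`∞ > u(x,t) = ∫ G(x-y,t) dμ(y) + ∫₀ᵗ ∫ G(x-y,t-s) |y|^(-γ) u(y,s)^p dy ds`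
for all `0 < t < T` and almost all `x`.  Only the values of `u` on `ℝᴺ × (0,T)` matter.  All integrals
are integrals of nonnegative functions with values in `[0,∞]`. -/
structure IsSolution (N : ℕ) (θ γ p : ℝ) (μ : Measure (EuclideanSpace ℝ (Fin N))) (T : EReal)
    (u : EuclideanSpace ℝ (Fin N) × ℝ → ℝ≥0∞) : Prop where
  aemeasurable : AEMeasurable u (volume.restrict {z | 0 < z.2 ∧ (z.2 : EReal) < T})
  duhamel : ∀ t : ℝ, 0 < t → (t : EReal) < T →
    ∀ᵐ x : EuclideanSpace ℝ (Fin N),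
      u (x, t) < ∞ ∧
      u (x, t) =
        (∫⁻ y, ENNReal.ofReal (G N θ (x - y) t) ∂μ) +
        ∫⁻ s in Ioo 0 t, ∫⁻ y : EuclideanSpace ℝ (Fin N),
          ENNReal.ofReal (G N θ (x - y) (t - s)) * ENNReal.ofReal (‖y‖ ^ (-γ)) * u (y, s) ^ p

/-- The problem with initial datum `μ` possesses a local-in-time solution. -/
def HasLocalSolution (N : ℕ) (θ γ p : ℝ) (μ : Measure (EuclideanSpace ℝ (Fin N))) : Prop :=
  ∃ T : EReal, 0 < T ∧ ∃ u : EuclideanSpace ℝ (Fin N) × ℝ → ℝ≥0∞, IsSolution N θ γ p μ T u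

/-- The measure `f dx` with which a nonnegative measurable function `f` is identified. -/
noncomputable def toMeasure {N : ℕ} (f : EuclideanSpace ℝ (Fin N) → ℝ) :
    Measure (EuclideanSpace ℝ (Fin N)) :=
  volume.withDensity (fun x => ENNReal.ofReal (f x))

/-- The exponent `p_γ = 1 + (θ - γ) / N`. -/
noncomputable def pCrit (N : ℕ) (θ γ : ℝ) : ℝ := 1 + (θ - γ) / N

end HardyParabolic

/-!
Write `β = (θ - γ) / (p - 1)`, so that `θ - γ - β p = -β`; the condition `p > p_γ` says `β < N`.
The whole problem is then invariant under the scaling `x ↦ ρ x`, `t ↦ ρ ^ θ t`,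
`u ↦ ρ ^ (-β) u`, and both halves are proved by comparison with functions of this homogeneity.

*Properties of `G`.* For `θ < 2` nonnegativity of `G` is not visible from the Fourier integral. With
`α = θ / 2 ≤ 1`, the power series of `1 - (1 - x) ^ α` has nonnegative coefficients of sum at most
one, hence so does that of its `m`-th power, and at `x = exp (-(t / m) ^ (1 / α) λ)` that power
tends to `exp (-t λ ^ α)`. With `λ` proportional to `‖ξ‖ ^ 2` this exhibits `G(·, t)` as an
iterated pointwise limit of sub-convex combinations of Gaussian densities
(`isRadialSubprob_stable`). Nonnegativity, radial monotonicity and mass at most one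
(`IsRadialSubprob`) survive such limits, the last by Fatou's lemma. Monotonicity and mass give
`G(x, t) ≤ C ‖x‖ ^ (-N)` by Chebyshev's inequality; together with the self-similarity `G_rpow` this
is all the decay that is needed (`exists_G_le`). A lower bound on a small parabolic ball follows from
continuity at the origin (`exists_le_G`).

*Nonexistence.* If `u(x, t) ≥ a t ^ (-β / θ)` on `‖x‖ < ε t ^ (1 / θ)` for all small `t`, inserting
this in the Duhamel term gives the same bound with `a` replaced by `c a ^ p`
(`SelfSimilarLowerBound.duhamel`), where `c` depends only on `N, θ, γ, p`. The datum provides a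
first value of `a` proportional to `C` (`lowerBound_linear`); for large `C` the iteration diverges and
`u` is infinite on a ball.

*Existence.* The profile `(max ‖x‖ (t ^ (1 / θ))) ^ (-β)` dominates, up to constants, both the linear
evolution of `‖x‖ ^ (-β)` (`exists_linear_le_profile`) and its own Duhamel term
(`exists_duhamel_le_profile`). Since the latter scales like a power `p > 1` of the amplitude, a small
multiple of the profile is a supersolution when the datum is small, and monotone iteration from zero
(`hasLocalSolution_of_supersolution`) yields a solution, which is global in time.
-/

namespace HardyParabolic

open Filter Topology

/-! ### The functions `exp (-t λ ^ α)` as limits of generating functions -/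

lemma succ_mul_choose_succ (α : ℝ) (k : ℕ) :
    ((k : ℝ) + 1) * Ring.choose α (k + 1) = (α - k) * Ring.choose α k := by
  have hk : (k.factorial : ℝ) ≠ 0 := by positivity
  rw [Ring.choose_eq_smul, Ring.choose_eq_smul, descPochhammer_succ_right, ← Polynomial.aeval_eq_smeval,
    ← Polynomial.aeval_eq_smeval, map_mul, Nat.factorial_succ]
  simp only [smul_eq_mul, map_sub, Polynomial.aeval_X, map_natCast]
  push_cast
  field_simp

/-- By the recursion `succ_mul_choose_succ`, only the first factor `α` of the numerator of
`(-1) ^ k * choose α k` has the opposite sign to the others, because `α ≤ 1`. -/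
lemma neg_one_pow_mul_choose_nonpos {α : ℝ} (h0 : 0 < α) (h1 : α ≤ 1) (k : ℕ) :
    (-1) ^ (k + 1) * Ring.choose α (k + 1) ≤ 0 := by
  induction k with
  | zero => simp [h0.le]
  | succ k ih =>
    have h := succ_mul_choose_succ α (k + 1)
    push_cast at h
    have h2 : ((k : ℝ) + 1 + 1) * ((-1) ^ (k + 1 + 1) * Ring.choose α (k + 1 + 1)) =
        (k + 1 - α) * ((-1) ^ (k + 1) * Ring.choose α (k + 1)) := by
      rw [pow_succ]; linear_combination -(-1) ^ (k + 1) * h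
    have h3 : 0 ≤ (k : ℝ) + 1 - α := by have : (0 : ℝ) ≤ k := k.cast_nonneg; linarith
    have h4 := mul_nonpos_of_nonneg_of_nonpos h3 ih
    rw [← h2] at h4
    have : (0 : ℝ) < k + 1 + 1 := by positivity
    nlinarith

lemma exists_hasSum_one_sub_one_sub_rpow {α : ℝ} (h0 : 0 < α) (h1 : α ≤ 1) :
    ∃ a : ℕ → ℝ, (∀ k, 0 ≤ a k) ∧
      ∀ x ∈ Ico (0 : ℝ) 1, HasSum (fun k => a k * x ^ k) (1 - (1 - x) ^ α) := by
  refine ⟨fun k => if k = 0 then 0 else -((-1) ^ k * Ring.choose α k), ?_, ?_⟩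
  · rintro (_ | k)
    · simp
    · simpa using neg_one_pow_mul_choose_nonpos h0 h1 k
  · intro x hx
    have hb := (Real.one_add_rpow_hasFPowerSeriesOnBall_zero (a := α)).hasSum (y := -x)
      (by simp [abs_of_nonneg hx.1, hx.2, enorm_eq_nnnorm, ← NNReal.coe_lt_coe])
    simp only [binomialSeries_apply, List.ofFn_const, List.prod_replicate, smul_eq_mul, zero_add] at hb
    have hs : HasSum (fun k : ℕ => if k = 0 then (1 : ℝ) else 0) 1 := by
      simpa using hasSum_ite_eq 0 (1 : ℝ)
    rw [sub_eq_add_neg 1 x]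
    suffices heq : ∀ k : ℕ, (if k = 0 then 0 else -((-1) ^ k * Ring.choose α k)) * x ^ k =
        (if k = 0 then 1 else 0) - Ring.choose α k * (-x) ^ k by
      simpa only [heq] using hs.sub hb
    intro k
    rcases k with _ | k
    · simp
    · simp only [Nat.succ_ne_zero, if_false]
      rw [neg_pow]; ring

/-- Truncations of the series for `1 - (1 - x) ^ α`. The sum of their coefficients is bounded by
letting `x → 1`. -/
lemma exists_polynomial_tendsto {α : ℝ} (h0 : 0 < α) (h1 : α ≤ 1) :
    ∃ P : ℕ → Polynomial ℝ, (∀ K k, 0 ≤ (P K).coeff k) ∧ (∀ K, (P K).eval 1 ≤ 1) ∧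
      ∀ x ∈ Ico (0 : ℝ) 1, Tendsto (fun K => (P K).eval x) atTop (𝓝 (1 - (1 - x) ^ α)) := by
  obtain ⟨a, ha, hs⟩ := exists_hasSum_one_sub_one_sub_rpow h0 h1
  set P : ℕ → Polynomial ℝ := fun K => ∑ k ∈ Finset.range K, Polynomial.monomial k (a k)
  have hP : ∀ K x, (P K).eval x = ∑ k ∈ Finset.range K, a k * x ^ k := by
    intro K x; simp [P, Polynomial.eval_finsetSum]
  refine ⟨P, ?_, ?_, ?_⟩
  · intro K k
    simp only [P, Polynomial.finsetSum_coeff, Polynomial.coeff_monomial]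
    exact Finset.sum_nonneg fun i _ => by split_ifs <;> simp [ha]
  · intro K
    have hc : Tendsto (fun x => (P K).eval x) (𝓝[<] (1 : ℝ)) (𝓝 ((P K).eval 1)) :=
      ((P K).continuous.tendsto 1).mono_left nhdsWithin_le_nhds
    refine le_of_tendsto hc ?_
    filter_upwards [Ioo_mem_nhdsLT (show (0 : ℝ) < 1 by norm_num)] with x hx
    rw [hP]
    refine (sum_le_hasSum _ (fun k _ => mul_nonneg (ha k) (pow_nonneg hx.1.le k))
      (hs x ⟨hx.1.le, hx.2⟩)).trans ?_
    have := Real.rpow_nonneg (show 0 ≤ 1 - x by linarith [hx.2]) α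
    linarith
  · intro x hx
    simp only [hP]
    exact (hs x hx).tendsto_sum_nat

lemma coeff_pow_nonneg {P : Polynomial ℝ} (hP : ∀ k, 0 ≤ P.coeff k) (m k : ℕ) :
    0 ≤ (P ^ m).coeff k := by
  induction m generalizing k with
  | zero => rw [pow_zero, Polynomial.coeff_one]; split_ifs <;> simp
  | succ m ih =>
    rw [pow_succ, Polynomial.coeff_mul]
    exact Finset.sum_nonneg fun i _ => mul_nonneg (ih _) (hP _)

/-- The probability generating functions `(1 - (1 - x) ^ α) ^ m`, evaluated at
`x = exp (-(t / m) ^ (1/α) l)`, converge to `exp (-t l ^ α)`: with `h = (t / m) ^ (1/α)` the `m`-th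
power is `(1 - (t / m) ((1 - exp (-h l)) / h) ^ α) ^ m`. The index is shifted so that `m > 0`. -/
lemma tendsto_generating_pow {α l t : ℝ} (h0 : 0 < α) (hl : 0 < l) (ht : 0 < t) :
    Tendsto (fun m : ℕ => (1 - (1 - Real.exp (-((t / (m + 1 : ℕ)) ^ α⁻¹ * l))) ^ α) ^ (m + 1)) atTop
      (𝓝 (Real.exp (-t * l ^ α))) := by
  set h : ℕ → ℝ := fun m => (t / m) ^ α⁻¹
  suffices H : Tendsto (fun m : ℕ => (1 - (1 - Real.exp (-(h m * l))) ^ α) ^ m) atTop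
      (𝓝 (Real.exp (-t * l ^ α))) from H.comp (tendsto_add_atTop_nat 1)
  simp only [sub_eq_add_neg (1 : ℝ) ((_ : ℝ) ^ α)]
  apply Real.tendsto_one_add_pow_exp_of_tendsto
  have hh : Tendsto h atTop (𝓝[≠] 0) := by
    rw [tendsto_nhdsWithin_iff]
    constructor
    · have h1 : Tendsto (fun m : ℕ => t / (m : ℝ)) atTop (𝓝 0) := tendsto_const_div_atTop_nhds_zero_nat t
      have := h1.rpow_const (p := α⁻¹) (Or.inr (by positivity))
      rwa [Real.zero_rpow (by positivity)] at this
    · filter_upwards [eventually_gt_atTop 0] with m hm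
      have : 0 < h m := Real.rpow_pos_of_pos (by positivity) _
      exact this.ne'
  have hd : HasDerivAt (fun s : ℝ => 1 - Real.exp (-(s * l))) l 0 := by
    have := (((hasDerivAt_id (0 : ℝ)).mul_const l).neg.exp).const_sub 1
    simpa using this
  have hq := (hd.tendsto_slope.comp hh).rpow_const (p := α) (Or.inr h0.le)
  have hq' := (hq.const_mul t).neg
  rw [← neg_mul] at hq'
  refine hq'.congr' ?_
  filter_upwards [eventually_gt_atTop 0] with m hm
  have hm' : (0 : ℝ) < m := by exact_mod_cast hm
  have hpos : 0 < h m := Real.rpow_pos_of_pos (by positivity) _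
  have hα : h m ^ α = t / m := by
    rw [← Real.rpow_mul (by positivity), inv_mul_cancel₀ h0.ne', Real.rpow_one]
  have hn : 0 ≤ 1 - Real.exp (-(h m * l)) := by
    have : Real.exp (-(h m * l)) ≤ 1 := Real.exp_le_one_iff.mpr (by have := mul_pos hpos hl; linarith)
    linarith
  simp only [Function.comp, slope_def_field, sub_zero, zero_mul, neg_zero, Real.exp_zero, sub_self]
  rw [Real.div_rpow hn hpos.le, hα]
  field_simp

/-! ### Radially nonincreasing sub-probability densities -/

section RadialKernels

variable {V : Type*} [NormedAddCommGroup V] [InnerProductSpace ℝ V] [FiniteDimensional ℝ V]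
  [MeasurableSpace V] [BorelSpace V]

/-- The real part of the inverse Fourier transform of a real-valued function. -/
noncomputable def reFourierInv (g : V → ℝ) (x : V) : ℝ :=
  (𝓕⁻ (fun ξ : V => ((g ξ : ℝ) : ℂ)) x).re

/-- Radially nonincreasing sub-probability densities: measurable nonnegative functions of total
mass at most one whose value at `y` is at most the value at `x` whenever `‖x‖ ≤ ‖y‖` (which in
particular makes them radial). -/
structure IsRadialSubprob (F : V → ℝ) : Prop where
  measurable : Measurable F
  nonneg : ∀ x, 0 ≤ F x
  anti : ∀ x y, ‖x‖ ≤ ‖y‖ → F y ≤ F x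
  lintegral_le : ∫⁻ x, ENNReal.ofReal (F x) ≤ 1

lemma IsRadialSubprob.of_tendsto {F : ℕ → V → ℝ} {F' : V → ℝ} (hF : ∀ n, IsRadialSubprob (F n))
    (h : ∀ x, Tendsto (fun n => F n x) atTop (𝓝 (F' x))) : IsRadialSubprob F' where
  measurable := measurable_of_tendsto_metrizable (fun n => (hF n).measurable)
    (tendsto_pi_nhds.mpr h)
  nonneg x := ge_of_tendsto' (h x) fun n => (hF n).nonneg x
  anti x y hxy := le_of_tendsto_of_tendsto' (h y) (h x) fun n => (hF n).anti x y hxy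
  lintegral_le := by
    have h1 : ∀ x, liminf (fun n => ENNReal.ofReal (F n x)) atTop = ENNReal.ofReal (F' x) :=
      fun x => (ENNReal.tendsto_ofReal (h x)).liminf_eq
    calc ∫⁻ x, ENNReal.ofReal (F' x)
        = ∫⁻ x, liminf (fun n => ENNReal.ofReal (F n x)) atTop := by simp only [h1]
      _ ≤ liminf (fun n => ∫⁻ x, ENNReal.ofReal (F n x)) atTop :=
        lintegral_liminf_le fun n => (hF n).measurable.ennreal_ofReal
      _ ≤ liminf (fun _ => (1 : ℝ≥0∞)) atTop :=
        liminf_le_liminf (Eventually.of_forall fun n => (hF n).lintegral_le)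
      _ = 1 := by simp

lemma IsRadialSubprob.sum {ι : Type*} (s : Finset ι) {b : ι → ℝ} {F : ι → V → ℝ}
    (hF : ∀ i, IsRadialSubprob (F i)) (hb : ∀ i, 0 ≤ b i) (hb1 : ∑ i ∈ s, b i ≤ 1) :
    IsRadialSubprob (fun x => ∑ i ∈ s, b i * F i x) where
  measurable := Finset.measurable_sum _ fun i _ => (hF i).measurable.const_mul _
  nonneg x := Finset.sum_nonneg fun i _ => mul_nonneg (hb i) ((hF i).nonneg x)
  anti x y hxy := Finset.sum_le_sum fun i _ => mul_le_mul_of_nonneg_left ((hF i).anti x y hxy) (hb i)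
  lintegral_le := by
    have h1 : ∀ x, ENNReal.ofReal (∑ i ∈ s, b i * F i x) =
        ∑ i ∈ s, ENNReal.ofReal (b i) * ENNReal.ofReal (F i x) := fun x => by
      rw [ENNReal.ofReal_sum_of_nonneg fun i _ => mul_nonneg (hb i) ((hF i).nonneg x)]
      exact Finset.sum_congr rfl fun i _ => ENNReal.ofReal_mul (hb i)
    simp only [h1]
    rw [lintegral_finsetSum _ fun i _ => (hF i).measurable.ennreal_ofReal.const_mul _]
    calc ∑ i ∈ s, ∫⁻ x, ENNReal.ofReal (b i) * ENNReal.ofReal (F i x)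
        ≤ ∑ i ∈ s, ENNReal.ofReal (b i) := Finset.sum_le_sum fun i _ => by
          rw [lintegral_const_mul _ (hF i).measurable.ennreal_ofReal]
          exact mul_le_of_le_one_right' (hF i).lintegral_le
      _ = ENNReal.ofReal (∑ i ∈ s, b i) := (ENNReal.ofReal_sum_of_nonneg fun i _ => hb i).symm
      _ ≤ 1 := by simpa using ENNReal.ofReal_le_ofReal hb1

/-- Chebyshev's inequality on the ball of radius `‖x‖`, on which `F` is at least `F x`. -/
lemma IsRadialSubprob.le_div {F : V → ℝ} (hF : IsRadialSubprob F) [Nontrivial V] {x : V}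
    (hx : x ≠ 0) :
    F x ≤ (volume.real (Metric.ball (0 : V) 1))⁻¹ * (‖x‖ ^ Module.finrank ℝ V)⁻¹ := by
  have hx' : 0 < ‖x‖ := norm_pos_iff.mpr hx
  have hv : 0 < volume.real (Metric.ball (0 : V) 1) :=
    ENNReal.toReal_pos (Metric.measure_ball_pos _ _ one_pos).ne' measure_ball_lt_top.ne
  have h1 : ENNReal.ofReal (F x) * volume (Metric.ball (0 : V) ‖x‖) ≤ 1 := by
    calc ENNReal.ofReal (F x) * volume (Metric.ball (0 : V) ‖x‖)
        = ∫⁻ _ in Metric.ball (0 : V) ‖x‖, ENNReal.ofReal (F x) := by rw [setLIntegral_const]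
      _ ≤ ∫⁻ y in Metric.ball (0 : V) ‖x‖, ENNReal.ofReal (F y) := by
        refine setLIntegral_mono' Metric.isOpen_ball.measurableSet fun y hy => ?_
        exact ENNReal.ofReal_le_ofReal (hF.anti _ _ (mem_ball_zero_iff.mp hy).le)
      _ ≤ ∫⁻ y, ENNReal.ofReal (F y) := setLIntegral_le_lintegral _ _
      _ ≤ 1 := hF.lintegral_le
  rw [Measure.addHaar_ball _ _ hx'.le, ← ENNReal.ofReal_toReal
    (measure_ball_lt_top (μ := volume) (x := (0 : V)) (r := 1)).ne, ← Measure.real,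
    ← ENNReal.ofReal_mul (by positivity), ← ENNReal.ofReal_mul (hF.nonneg x),
    ENNReal.ofReal_le_one] at h1
  rw [← mul_inv, ← one_div, le_div_iff₀ (by positivity)]
  linarith

lemma tendsto_reFourierInv {g : ℕ → V → ℝ} {g' b : V → ℝ} (hg : ∀ n, Measurable (g n))
    (hb : Integrable b) (hgb : ∀ n, ∀ᵐ ξ, |g n ξ| ≤ b ξ)
    (h : ∀ᵐ ξ, Tendsto (fun n => g n ξ) atTop (𝓝 (g' ξ))) (x : V) :
    Tendsto (fun n => reFourierInv (g n) x) atTop (𝓝 (reFourierInv g' x)) := by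
  refine (Complex.continuous_re.tendsto _).comp ?_
  simp only [Real.fourierInv_eq']
  refine tendsto_integral_of_dominated_convergence b (fun n => ?_) hb (fun n => ?_) ?_
  · have := hg n
    exact Measurable.aestronglyMeasurable (by fun_prop)
  · filter_upwards [hgb n] with ξ hξ
    rw [norm_smul, Complex.norm_exp_ofReal_mul_I, one_mul, Complex.norm_real]
    exact hξ
  · filter_upwards [h] with ξ hξ
    exact ((Complex.continuous_ofReal.tendsto _).comp hξ).const_smul _

lemma reFourierInv_sum {ι : Type*} (s : Finset ι) {b : ι → ℝ} {g : ι → V → ℝ}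
    (hg : ∀ i, Integrable (g i)) (x : V) :
    reFourierInv (fun ξ => ∑ i ∈ s, b i * g i ξ) x = ∑ i ∈ s, b i * reFourierInv (g i) x := by
  simp only [reFourierInv, Real.fourierInv_eq']
  have hi : ∀ i, Integrable (fun v : V => Complex.exp (↑(2 * Real.pi * inner ℝ v x) * Complex.I) •
      ((g i v : ℝ) : ℂ)) := fun i => by
    refine ((hg i).ofReal (𝕜 := ℂ)).bdd_mul (c := 1) ?_ ?_
    · exact Continuous.aestronglyMeasurable (by fun_prop)
    · exact Eventually.of_forall fun v => (Complex.norm_exp_ofReal_mul_I _).le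
  have : ∀ v : V, Complex.exp (↑(2 * Real.pi * inner ℝ v x) * Complex.I) •
      (((∑ i ∈ s, b i * g i v : ℝ)) : ℂ) = ∑ i ∈ s, (b i : ℂ) *
      (Complex.exp (↑(2 * Real.pi * inner ℝ v x) * Complex.I) • ((g i v : ℝ) : ℂ)) := fun v => by
    push_cast
    rw [Finset.smul_sum]
    refine Finset.sum_congr rfl fun i _ => ?_
    simp only [smul_eq_mul]; ring
  simp only [this]
  rw [integral_finsetSum _ fun i _ => (hi i).const_mul _, Complex.re_sum]
  refine Finset.sum_congr rfl fun i _ => ?_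
  rw [integral_const_mul, Complex.re_ofReal_mul]

lemma integrable_exp_neg_mul_norm_rpow [Nontrivial V] {b q : ℝ} (hb : 0 < b) (hq : 0 < q) :
    Integrable (fun ξ : V => Real.exp (-b * ‖ξ‖ ^ q)) := by
  rw [integrable_fun_norm_addHaar volume (f := fun r : ℝ => Real.exp (-b * r ^ q))]
  have := integrableOn_rpow_mul_exp_neg_mul_rpow (s := (Module.finrank ℝ V - 1 : ℕ)) (p := q) (b := b)
    (by have : (0 : ℝ) ≤ (Module.finrank ℝ V - 1 : ℕ) := Nat.cast_nonneg _
        linarith) hq hb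
  simpa only [Real.rpow_natCast, smul_eq_mul] using this

lemma integrable_exp_neg_mul_norm_sq {b : ℝ} (hb : 0 < b) :
    Integrable (fun ξ : V => Real.exp (-b * ‖ξ‖ ^ 2)) := by
  by_contra h
  have h1 := GaussianFourier.integral_rexp_neg_mul_sq_norm (V := V) hb
  rw [integral_undef h] at h1
  have : 0 < (Real.pi / b) ^ (Module.finrank ℝ V / 2 : ℝ) :=
    Real.rpow_pos_of_pos (by positivity) _
  linarith

lemma reFourierInv_gaussian {b : ℝ} (hb : 0 < b) (x : V) :
    reFourierInv (fun ξ : V => Real.exp (-b * ‖ξ‖ ^ 2)) x =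
      (Real.pi / b) ^ (Module.finrank ℝ V / 2 : ℝ) * Real.exp (-(Real.pi ^ 2 / b) * ‖x‖ ^ 2) := by
  have h := fourier_gaussian_innerProductSpace (V := V) (b := (b : ℂ)) (by simpa using hb) (-x)
  rw [← Real.fourierInv_eq_fourier_neg] at h
  have e : (fun ξ : V => ((Real.exp (-b * ‖ξ‖ ^ 2) : ℝ) : ℂ)) =
      fun v : V => Complex.exp (-b * ‖v‖ ^ 2) := by ext v; push_cast; rfl
  rw [reFourierInv, e, h, norm_neg]
  have e2 : ((Real.pi : ℂ) / b) ^ (Module.finrank ℝ V / 2 : ℂ) *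
      Complex.exp (-Real.pi ^ 2 * ‖x‖ ^ 2 / b) = (((Real.pi / b) ^ (Module.finrank ℝ V / 2 : ℝ) *
        Real.exp (-(Real.pi ^ 2 / b) * ‖x‖ ^ 2) : ℝ) : ℂ) := by
    rw [Complex.ofReal_mul, Complex.ofReal_cpow (by positivity)]
    push_cast
    congr 2
    ring
  rw [e2, Complex.ofReal_re]

lemma isRadialSubprob_gaussian {b : ℝ} (hb : 0 < b) :
    IsRadialSubprob (reFourierInv (fun ξ : V => Real.exp (-b * ‖ξ‖ ^ 2))) := by
  rw [show reFourierInv (fun ξ : V => Real.exp (-b * ‖ξ‖ ^ 2)) = _ from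
    funext fun x => reFourierInv_gaussian hb x]
  have hp : 0 < (Real.pi / b) ^ (Module.finrank ℝ V / 2 : ℝ) :=
    Real.rpow_pos_of_pos (by positivity) _
  have hb' : 0 < Real.pi ^ 2 / b := by positivity
  refine ⟨by fun_prop, fun x => by positivity, fun x y hxy => ?_, ?_⟩
  · gcongr _ * Real.exp ?_
    have : ‖x‖ ^ 2 ≤ ‖y‖ ^ 2 := by gcongr
    nlinarith
  · rw [← ofReal_integral_eq_lintegral_ofReal ((integrable_exp_neg_mul_norm_sq hb').const_mul _)
      (Eventually.of_forall fun x => by positivity), integral_const_mul,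
      GaussianFourier.integral_rexp_neg_mul_sq_norm hb', ← Real.mul_rpow (by positivity)
      (by positivity)]
    have : Real.pi / b * (Real.pi / (Real.pi ^ 2 / b)) = 1 := by
      have := Real.pi_pos.ne'; field_simp
    rw [this, Real.one_rpow, ENNReal.ofReal_one]

lemma isRadialSubprob_polynomial {P : Polynomial ℝ} (hP : ∀ k, 0 ≤ P.coeff k) (hP1 : P.eval 1 ≤ 1)
    {δ h : ℝ} (hδ : 0 < δ) (hh : 0 ≤ h) :
    IsRadialSubprob (reFourierInv
      (fun ξ : V => Real.exp (-δ * ‖ξ‖ ^ 2) * P.eval (Real.exp (-(h * ‖ξ‖ ^ 2))))) := by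
  have hk : ∀ k : ℕ, 0 < δ + k * h := fun k => by positivity
  have e : (fun ξ : V => Real.exp (-δ * ‖ξ‖ ^ 2) * P.eval (Real.exp (-(h * ‖ξ‖ ^ 2)))) =
      fun ξ => ∑ k ∈ Finset.range (P.natDegree + 1),
        P.coeff k * Real.exp (-(δ + k * h) * ‖ξ‖ ^ 2) := by
    ext ξ
    rw [Polynomial.eval_eq_sum_range, Finset.mul_sum]
    refine Finset.sum_congr rfl fun k _ => ?_
    rw [← Real.exp_nat_mul, mul_left_comm, ← Real.exp_add]
    congr 2; ring
  rw [e, show reFourierInv _ = _ from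
    funext fun x => reFourierInv_sum _ (fun k => integrable_exp_neg_mul_norm_sq (hk k)) x]
  refine IsRadialSubprob.sum _ (fun k => isRadialSubprob_gaussian (hk k)) hP ?_
  simpa [Polynomial.eval_eq_sum_range] using hP1

lemma abs_eval_le_one {P : Polynomial ℝ} (hP : ∀ k, 0 ≤ P.coeff k) (hP1 : P.eval 1 ≤ 1) {x : ℝ}
    (hx : 0 ≤ x) (hx1 : x ≤ 1) : |P.eval x| ≤ 1 := by
  rw [Polynomial.eval_eq_sum_range] at hP1 ⊢
  rw [abs_of_nonneg (Finset.sum_nonneg fun k _ => mul_nonneg (hP k) (pow_nonneg hx k))]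
  refine le_trans (Finset.sum_le_sum fun k _ => ?_) hP1
  gcongr
  exact hP k

/-- The radial profile `exp (-t λ ^ α)`, `λ = ‖ξ‖ ^ 2`, is a limit of convex combinations of the
Gaussians `exp (-s λ)`. The factor `exp (-δ λ)` keeps the approximations integrable until the
last limit `δ → 0`. -/
lemma isRadialSubprob_stable [Nontrivial V] {α t : ℝ} (h0 : 0 < α) (h1 : α ≤ 1) (ht : 0 < t) :
    IsRadialSubprob (reFourierInv (fun ξ : V => Real.exp (-t * (‖ξ‖ ^ 2) ^ α))) := by
  obtain ⟨P, hPc, hP1, hPt⟩ := exists_polynomial_tendsto h0 h1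
  have hPm1 : ∀ K m, ((P K) ^ m).eval 1 ≤ 1 := fun K m => by
    rw [Polynomial.eval_pow]
    refine pow_le_one₀ ?_ (hP1 K)
    rw [Polynomial.eval_eq_sum_range]
    exact Finset.sum_nonneg fun k _ => by simpa using hPc K k
  have hpos : ∀ᵐ ξ : V, 0 < ‖ξ‖ ^ 2 := by
    filter_upwards [compl_mem_ae_iff.mpr (measure_singleton (0 : V))] with ξ hξ
    have : 0 < ‖ξ‖ := norm_pos_iff.mpr hξ
    positivity
  have hbase : ∀ {h : ℝ} (ξ : V), 0 ≤ h → Real.exp (-(h * ‖ξ‖ ^ 2)) ≤ 1 := fun ξ hh =>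
    Real.exp_le_one_iff.mpr (by have := mul_nonneg hh (sq_nonneg ‖ξ‖); linarith)
  -- generating functions with a Gaussian regularisation
  have step1 : ∀ (δ h : ℝ) (m : ℕ), 0 < δ → 0 < h → IsRadialSubprob (reFourierInv
      (fun ξ : V => Real.exp (-δ * ‖ξ‖ ^ 2) *
        (1 - (1 - Real.exp (-(h * ‖ξ‖ ^ 2))) ^ α) ^ m)) := by
    intro δ h m hδ hh
    refine IsRadialSubprob.of_tendsto (fun K => isRadialSubprob_polynomial (P := P K ^ m)
      (coeff_pow_nonneg (hPc K) m) (hPm1 K m) hδ hh.le) ?_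
    refine tendsto_reFourierInv (fun K => ?_) (integrable_exp_neg_mul_norm_sq hδ) (fun K => ?_) ?_
    · have := ((P K) ^ m).continuous
      exact Continuous.measurable (by fun_prop)
    · refine Eventually.of_forall fun ξ => ?_
      rw [abs_mul, abs_of_nonneg (Real.exp_pos _).le]
      exact mul_le_of_le_one_right (Real.exp_pos _).le (abs_eval_le_one
        (coeff_pow_nonneg (hPc K) m) (hPm1 K m) (Real.exp_pos _).le (hbase ξ hh.le))
    · filter_upwards [hpos] with ξ hξ
      simp only [Polynomial.eval_pow]
      refine ((hPt _ ⟨(Real.exp_pos _).le, ?_⟩).pow m).const_mul _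
      exact Real.exp_lt_one_iff.mpr (by have := mul_pos hh hξ; linarith)
  have step2 : ∀ δ : ℝ, 0 < δ → IsRadialSubprob (reFourierInv
      (fun ξ : V => Real.exp (-δ * ‖ξ‖ ^ 2) * Real.exp (-t * (‖ξ‖ ^ 2) ^ α))) := by
    intro δ hδ
    have hhm : ∀ m : ℕ, 0 < (t / (m + 1 : ℕ)) ^ α⁻¹ := fun m =>
      Real.rpow_pos_of_pos (by positivity) _
    refine IsRadialSubprob.of_tendsto (fun m : ℕ => step1 δ _ (m + 1) hδ (hhm m)) ?_
    refine tendsto_reFourierInv (fun m => ?_) (integrable_exp_neg_mul_norm_sq hδ) (fun m => ?_) ?_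
    · fun_prop
    · refine Eventually.of_forall fun ξ => ?_
      rw [abs_mul, abs_of_nonneg (Real.exp_pos _).le]
      refine mul_le_of_le_one_right (Real.exp_pos _).le ?_
      have h2 := hbase ξ (hhm m).le
      have h3 : 0 ≤ 1 - Real.exp (-((t / (m + 1 : ℕ)) ^ α⁻¹ * ‖ξ‖ ^ 2)) := by linarith
      have h4 : (1 - Real.exp (-((t / (m + 1 : ℕ)) ^ α⁻¹ * ‖ξ‖ ^ 2))) ^ α ≤ 1 :=
        Real.rpow_le_one h3 (by linarith [Real.exp_pos (-((t / (m + 1 : ℕ)) ^ α⁻¹ * ‖ξ‖ ^ 2))]) h0.le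
      have h5 := Real.rpow_nonneg h3 α
      rw [abs_pow]
      exact pow_le_one₀ (abs_nonneg _) (abs_le.mpr ⟨by linarith, by linarith⟩)
    · filter_upwards [hpos] with ξ hξ
      exact (tendsto_generating_pow h0 hξ ht).const_mul _
  refine IsRadialSubprob.of_tendsto (fun n : ℕ => step2 (1 / ((n : ℝ) + 1)) (by positivity)) ?_
  refine tendsto_reFourierInv (b := fun ξ : V => Real.exp (-t * (‖ξ‖ ^ 2) ^ α))
    (fun m => by fun_prop) ?_ (fun n => ?_) ?_
  · have := integrable_exp_neg_mul_norm_rpow (V := V) ht (q := 2 * α) (by positivity)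
    refine this.congr (Eventually.of_forall fun ξ => ?_)
    simp only [Real.rpow_mul (norm_nonneg _), Real.rpow_two]
  · refine Eventually.of_forall fun ξ => ?_
    rw [abs_of_nonneg (by positivity)]
    refine mul_le_of_le_one_left (Real.exp_pos _).le ?_
    simpa [neg_mul] using hbase ξ (h := 1 / ((n : ℝ) + 1)) (by positivity)
  · refine Eventually.of_forall fun ξ => ?_
    have h2 : Tendsto (fun n : ℕ => Real.exp (-(1 / ((n : ℝ) + 1)) * ‖ξ‖ ^ 2)) atTop (𝓝 1) := by
      have := ((tendsto_one_div_add_atTop_nhds_zero_nat (𝕜 := ℝ)).neg.mul_const (‖ξ‖ ^ 2)).rexp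
      simpa using this
    simpa only [one_mul] using h2.mul_const (Real.exp (-t * (‖ξ‖ ^ 2) ^ α))

end RadialKernels

/-! ### The fundamental solution -/

section FundamentalSolution

variable {N : ℕ} {θ : ℝ}

lemma isRadialSubprob_G (hN : 1 ≤ N) (h0 : 0 < θ) (h2 : θ ≤ 2) {t : ℝ} (ht : 0 < t) :
    IsRadialSubprob (fun x => G N θ x t) := by
  have : NeZero N := ⟨by omega⟩
  have h := isRadialSubprob_stable (V := EuclideanSpace ℝ (Fin N)) (α := θ / 2)
    (t := t * (2 * Real.pi) ^ θ) (by positivity) (by linarith) (by positivity)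
  suffices e : ∀ ξ : EuclideanSpace ℝ (Fin N), -(t * (2 * Real.pi) ^ θ) * (‖ξ‖ ^ 2) ^ (θ / 2) =
      -t * (2 * Real.pi * ‖ξ‖) ^ θ by
    simp only [e] at h
    exact h
  intro ξ
  rw [Real.mul_rpow (by positivity) (norm_nonneg _), ← Real.rpow_two, ← Real.rpow_mul (norm_nonneg _),
    show 2 * (θ / 2) = θ by ring]
  ring

/-- Self-similarity of the fundamental solution, with `t = ρ ^ θ`. -/
lemma G_rpow (x : EuclideanSpace ℝ (Fin N)) {ρ : ℝ} (hρ : 0 < ρ) :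
    G N θ x (ρ ^ θ) = (ρ ^ N)⁻¹ * G N θ (ρ⁻¹ • x) 1 := by
  simp only [G, Real.fourierInv_eq']
  have h := Measure.integral_comp_smul (volume : Measure (EuclideanSpace ℝ (Fin N)))
    (fun v => Complex.exp (↑(2 * Real.pi * inner ℝ v (ρ⁻¹ • x)) * Complex.I) •
      ((Real.exp (-1 * (2 * Real.pi * ‖v‖) ^ θ) : ℝ) : ℂ)) ρ
  rw [finrank_euclideanSpace_fin, abs_of_pos (by positivity)] at h
  rw [← Complex.re_ofReal_mul, ← Complex.real_smul, ← h]
  congr 2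
  ext v
  have e1 : inner ℝ (ρ • v) (ρ⁻¹ • x) = inner ℝ v x := by
    rw [inner_smul_left, inner_smul_right]
    simp [hρ.ne']
  have e2 : (2 * Real.pi * ‖ρ • v‖) ^ θ = ρ ^ θ * (2 * Real.pi * ‖v‖) ^ θ := by
    rw [norm_smul, Real.norm_of_nonneg hρ.le, mul_left_comm, Real.mul_rpow hρ.le (by positivity)]
  rw [e1, e2, neg_one_mul, neg_mul]

lemma integrable_exp_neg_two_pi_norm_rpow (hN : 1 ≤ N) (h0 : 0 < θ) :
    Integrable (fun ξ : EuclideanSpace ℝ (Fin N) => Real.exp (-1 * (2 * Real.pi * ‖ξ‖) ^ θ)) := by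
  have : NeZero N := ⟨by omega⟩
  refine (integrable_exp_neg_mul_norm_rpow (V := EuclideanSpace ℝ (Fin N))
    (b := (2 * Real.pi) ^ θ) (by positivity) h0).congr (Eventually.of_forall fun ξ => ?_)
  simp only [Real.mul_rpow (show (0 : ℝ) ≤ 2 * Real.pi by positivity) (norm_nonneg ξ)]
  congr 1; ring

lemma G_zero_one_pos (hN : 1 ≤ N) (h0 : 0 < θ) : 0 < G N θ 0 1 := by
  simp only [G, Real.fourierInv_eq', inner_zero_right, mul_zero, Complex.ofReal_zero, zero_mul,
    Complex.exp_zero, one_smul]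
  rw [integral_complex_ofReal, Complex.ofReal_re]
  exact integral_exp_pos (integrable_exp_neg_two_pi_norm_rpow hN h0)

lemma continuous_G_one (hN : 1 ≤ N) (h0 : 0 < θ) : Continuous fun x => G N θ x 1 := by
  simp only [G, Real.fourierInv_eq']
  refine Complex.continuous_re.comp ?_
  refine continuous_of_dominated (bound := fun ξ : EuclideanSpace ℝ (Fin N) =>
    Real.exp (-1 * (2 * Real.pi * ‖ξ‖) ^ θ)) (fun x => ?_) (fun x => ?_)
    (integrable_exp_neg_two_pi_norm_rpow hN h0) ?_
  · exact Measurable.aestronglyMeasurable (by fun_prop)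
  · refine Eventually.of_forall fun ξ => ?_
    rw [norm_smul, Complex.norm_exp_ofReal_mul_I, one_mul, Complex.norm_real,
      Real.norm_of_nonneg (Real.exp_pos _).le]
  · exact Eventually.of_forall fun ξ => by fun_prop

/-- The fundamental solution at time `ρ ^ θ` is at least a multiple of `ρ ^ (-N)` on a ball of
radius comparable to `ρ`. -/
lemma exists_le_G (hN : 1 ≤ N) (h0 : 0 < θ) :
    ∃ η c : ℝ, 0 < η ∧ 0 < c ∧ ∀ (ρ : ℝ) (z : EuclideanSpace ℝ (Fin N)), 0 < ρ → ‖z‖ < η * ρ →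
      c * (ρ ^ N)⁻¹ ≤ G N θ z (ρ ^ θ) := by
  have hpos := G_zero_one_pos hN h0
  have hc := (continuous_G_one hN h0).continuousAt (x := 0)
  obtain ⟨η, hη, h⟩ := Metric.eventually_nhds_iff.mp
    (hc.eventually (lt_mem_nhds (half_lt_self hpos)))
  refine ⟨η, G N θ 0 1 / 2, hη, half_pos hpos, fun ρ z hρ hz => ?_⟩
  rw [G_rpow z hρ, mul_comm]
  gcongr
  refine (h ?_).le
  rw [dist_zero_right, norm_smul, norm_inv, Real.norm_of_nonneg hρ.le, inv_mul_lt_iff₀ hρ, mul_comm]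
  exact hz

/-- The fundamental solution at time `ρ ^ θ` is at most a multiple of `(max ‖z‖ ρ) ^ (-N)`,
formulated for any `r` below that maximum. -/
lemma exists_G_le (hN : 1 ≤ N) (h0 : 0 < θ) (h2 : θ ≤ 2) :
    ∃ C : ℝ, 0 < C ∧ ∀ (ρ r : ℝ) (z : EuclideanSpace ℝ (Fin N)), 0 < ρ → 0 < r →
      (r ≤ ‖z‖ ∨ r ≤ ρ) → G N θ z (ρ ^ θ) ≤ C * (r ^ N)⁻¹ := by
  have : NeZero N := ⟨by omega⟩
  set v := (volume.real (Metric.ball (0 : EuclideanSpace ℝ (Fin N)) 1))⁻¹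
  have hv : 0 ≤ v := by positivity
  have hpos := G_zero_one_pos hN h0
  refine ⟨v + G N θ 0 1, by positivity, fun ρ r z hρ hr h => ?_⟩
  have hG := isRadialSubprob_G hN h0 h2 (Real.rpow_pos_of_pos hρ θ)
  rw [add_mul]
  rcases h with h | h
  · have h3 := hG.le_div (x := z) (norm_pos_iff.mp (hr.trans_le h))
    rw [finrank_euclideanSpace_fin] at h3
    have h4 : v * (‖z‖ ^ N)⁻¹ ≤ v * (r ^ N)⁻¹ := by gcongr
    have : 0 ≤ G N θ 0 1 * (r ^ N)⁻¹ := by positivity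
    linarith
  · have h3 := hG.anti 0 z (by simp)
    simp only [G_rpow (0 : EuclideanSpace ℝ (Fin N)) hρ, smul_zero] at h3
    have h4 : (ρ ^ N)⁻¹ * G N θ 0 1 ≤ (r ^ N)⁻¹ * G N θ 0 1 := by gcongr
    have : 0 ≤ v * (r ^ N)⁻¹ := by positivity
    linarith

lemma measurable_G : Measurable fun z : EuclideanSpace ℝ (Fin N) × ℝ => G N θ z.1 z.2 := by
  simp only [G, Real.fourierInv_eq']
  refine Complex.measurable_re.comp ?_
  refine StronglyMeasurable.measurable ?_
  refine StronglyMeasurable.integral_prod_right (f := fun (z : EuclideanSpace ℝ (Fin N) × ℝ)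
    (v : EuclideanSpace ℝ (Fin N)) => Complex.exp (↑(2 * Real.pi * inner ℝ v z.1) * Complex.I) •
      ((Real.exp (-z.2 * (2 * Real.pi * ‖v‖) ^ θ) : ℝ) : ℂ)) ?_
  refine Measurable.stronglyMeasurable ?_
  simp only [Function.uncurry_def]
  fun_prop

end FundamentalSolution

/-! ### Nonexistence for large singular data -/

section Nonexistence

variable {N : ℕ} {θ γ p β : ℝ}

lemma ae_ne_zero (hN : 1 ≤ N) : ∀ᵐ y : EuclideanSpace ℝ (Fin N), y ≠ 0 := by
  have : NeZero N := ⟨by omega⟩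
  exact compl_mem_ae_iff.mpr (measure_singleton (0 : EuclideanSpace ℝ (Fin N)))

lemma volume_ball_zero (hN : 1 ≤ N) {r : ℝ} (hr : 0 ≤ r) :
    volume (Metric.ball (0 : EuclideanSpace ℝ (Fin N)) r) =
      ENNReal.ofReal (r ^ N * volume.real (Metric.ball (0 : EuclideanSpace ℝ (Fin N)) 1)) := by
  have : NeZero N := ⟨by omega⟩
  rw [Measure.addHaar_ball _ _ hr, finrank_euclideanSpace_fin, ENNReal.ofReal_mul (by positivity),
    Measure.real, ENNReal.ofReal_toReal measure_ball_lt_top.ne]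

lemma ofReal_mul_ball_le_lintegral (hN : 1 ≤ N) {r m : ℝ} (hr : 0 ≤ r) (hm : 0 ≤ m)
    {g : EuclideanSpace ℝ (Fin N) → ℝ≥0∞} (h : ∀ᵐ y, ‖y‖ < r → ENNReal.ofReal m ≤ g y) :
    ENNReal.ofReal (m * (r ^ N * volume.real (Metric.ball (0 : EuclideanSpace ℝ (Fin N)) 1))) ≤
      ∫⁻ y, g y := by
  rw [ENNReal.ofReal_mul hm, ← volume_ball_zero hN hr, ← setLIntegral_const]
  refine le_trans (lintegral_mono_ae ?_) (setLIntegral_le_lintegral (Metric.ball 0 r) g)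
  refine (ae_restrict_iff' Metric.isOpen_ball.measurableSet).mpr ?_
  filter_upwards [h] with y hy hyr
  exact hy (mem_ball_zero_iff.mp hyr)

/-- The time-`ρ ^ θ` section of `u` is at least `a ρ ^ (-β)` near the origin, on the parabolic
scale `‖x‖ < ε ρ`, for all `ρ < R`. -/
def SelfSimilarLowerBound (θ β ε R : ℝ) (u : EuclideanSpace ℝ (Fin N) × ℝ → ℝ≥0∞) (a : ℝ) : Prop :=
  ∀ ρ : ℝ, 0 < ρ → ρ < R → ∀ᵐ x, ‖x‖ < ε * ρ → ENNReal.ofReal (a * ρ ^ (-β)) ≤ u (x, ρ ^ θ)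

/-- The linear part of the Duhamel formula gives the first lower bound. -/
lemma lowerBound_linear (hN : 1 ≤ N) (hβ : 0 ≤ β) {η c ε δ C ρ : ℝ} (hc : 0 < c)
    (hε : 0 < ε) (hεη : 2 * ε ≤ η) (hC : 0 ≤ C) (hρ : 0 < ρ) (hρδ : ε * ρ ≤ δ)
    (hG : ∀ (ρ : ℝ) (z : EuclideanSpace ℝ (Fin N)), 0 < ρ → ‖z‖ < η * ρ →
      c * (ρ ^ N)⁻¹ ≤ G N θ z (ρ ^ θ))
    {f : EuclideanSpace ℝ (Fin N) → ℝ} (hf : AEMeasurable f)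
    (hfδ : ∀ᵐ x, ‖x‖ < δ → C * ‖x‖ ^ (-β) ≤ f x) {x : EuclideanSpace ℝ (Fin N)}
    (hx : ‖x‖ < ε * ρ) :
    ENNReal.ofReal (c * ε ^ (-β) * ε ^ N *
        volume.real (Metric.ball (0 : EuclideanSpace ℝ (Fin N)) 1) * C * ρ ^ (-β)) ≤
      ∫⁻ y, ENNReal.ofReal (G N θ (x - y) (ρ ^ θ)) ∂(toMeasure f) := by
  have hGm : Measurable fun y => ENNReal.ofReal (G N θ (x - y) (ρ ^ θ)) :=
    (measurable_G.comp (by fun_prop : Measurable fun y : EuclideanSpace ℝ (Fin N) =>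
      (x - y, ρ ^ θ))).ennreal_ofReal
  rw [toMeasure, lintegral_withDensity_eq_lintegral_mul₀ hf.ennreal_ofReal hGm.aemeasurable]
  have hm : 0 ≤ C * (ε * ρ) ^ (-β) * (c * (ρ ^ N)⁻¹) := by positivity
  refine le_trans (le_of_eq ?_) (ofReal_mul_ball_le_lintegral hN
    (r := ε * ρ) (m := C * (ε * ρ) ^ (-β) * (c * (ρ ^ N)⁻¹)) (by positivity) hm ?_)
  · congr 1
    rw [Real.mul_rpow hε.le hρ.le, mul_pow]
    field_simp
  · filter_upwards [hfδ, ae_ne_zero hN] with y hy hy0 hyr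
    have hy0' : 0 < ‖y‖ := norm_pos_iff.mpr hy0
    rw [Pi.mul_apply, ENNReal.ofReal_mul (by positivity)]
    gcongr
    · refine le_trans ?_ (hy (hyr.trans_le hρδ))
      exact mul_le_mul_of_nonneg_left
        (Real.rpow_le_rpow_of_nonpos hy0' hyr.le (neg_nonpos.mpr hβ)) hC
    · refine hG ρ _ hρ ?_
      have := norm_sub_le x y
      nlinarith

/-- The Duhamel term improves a self-similar lower bound, the time integral being restricted to
`(ρ ^ θ / 4, ρ ^ θ / 2)`. -/
lemma SelfSimilarLowerBound.duhamel (hN : 1 ≤ N) (hθ : 0 < θ) (hγ : 0 < γ) (hp : 1 < p)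
    (hβ : 0 ≤ β) (hscale : θ - γ - β * p = -β) {η c ε q R a : ℝ} (hc : 0 < c)
    (hε : 0 < ε) (hq : 0 < q) (hqθ : q ^ θ = 1 / 4) (hεη : 2 * ε ≤ η * q) (ha : 0 ≤ a)
    (hG : ∀ (ρ : ℝ) (z : EuclideanSpace ℝ (Fin N)), 0 < ρ → ‖z‖ < η * ρ →
      c * (ρ ^ N)⁻¹ ≤ G N θ z (ρ ^ θ))
    {u : EuclideanSpace ℝ (Fin N) × ℝ → ℝ≥0∞} (hu : SelfSimilarLowerBound θ β ε R u a)
    {ρ : ℝ} (hρ : 0 < ρ) (hρR : ρ < R) {x : EuclideanSpace ℝ (Fin N)} (hx : ‖x‖ < ε * ρ) :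
    ENNReal.ofReal (c * (ε * q) ^ (-γ) * (ε * q) ^ N *
        volume.real (Metric.ball (0 : EuclideanSpace ℝ (Fin N)) 1) / 4 * a ^ p * ρ ^ (-β)) ≤
      ∫⁻ s in Ioo 0 (ρ ^ θ), ∫⁻ y : EuclideanSpace ℝ (Fin N),
        ENNReal.ofReal (G N θ (x - y) (ρ ^ θ - s)) * ENNReal.ofReal (‖y‖ ^ (-γ)) * u (y, s) ^ p := by
  set v := volume.real (Metric.ball (0 : EuclideanSpace ℝ (Fin N)) 1)
  have hv : 0 ≤ v := by positivity
  set t := ρ ^ θ with ht_def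
  have ht : 0 < t := Real.rpow_pos_of_pos hρ θ
  set k := ε * q with hk_def
  have hk : 0 < k := mul_pos hε hq
  set m := c * (ρ ^ N)⁻¹ * (k * ρ) ^ (-γ) * (a * ρ ^ (-β)) ^ p with hm_def
  have hm : 0 ≤ m := by positivity
  have hroot : ∀ s : ℝ, 0 < s → (s ^ θ⁻¹) ^ θ = s := fun s hs => by
    rw [← Real.rpow_mul hs.le, inv_mul_cancel₀ hθ.ne', Real.rpow_one]
  have hroot_lt : ∀ s : ℝ, 0 < s → s < t → s ^ θ⁻¹ < ρ := fun s hs hst => by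
    rw [← Real.rpow_lt_rpow_iff (by positivity) hρ.le hθ, hroot s hs]; exact hst
  have hroot_ge : ∀ s : ℝ, t / 4 ≤ s → q * ρ ≤ s ^ θ⁻¹ := fun s hs => by
    have hs0 : 0 < s := by linarith
    rw [← Real.rpow_le_rpow_iff (by positivity) (by positivity) hθ, hroot s hs0,
      Real.mul_rpow hq.le hρ.le, hqθ]
    linarith
  have hinner : ∀ s ∈ Ioo (t / 4) (t / 2), ENNReal.ofReal (m * ((k * ρ) ^ N * v)) ≤
      ∫⁻ y : EuclideanSpace ℝ (Fin N),
        ENNReal.ofReal (G N θ (x - y) (t - s)) * ENNReal.ofReal (‖y‖ ^ (-γ)) * u (y, s) ^ p := by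
    intro s hs
    have hs0 : 0 < s := by linarith [hs.1]
    have hσ := hroot s hs0
    have hσρ := hroot_lt s hs0 (by linarith [hs.2])
    have hσk := hroot_ge s hs.1.le
    have hts : 0 < t - s := by linarith [hs.2]
    have hτ := hroot (t - s) hts
    have hτρ := hroot_lt (t - s) hts (by linarith)
    have hτk := hroot_ge (t - s) (by linarith [hs.2])
    have hσ0 : 0 < s ^ θ⁻¹ := Real.rpow_pos_of_pos hs0 _
    have hτ0 : 0 < (t - s) ^ θ⁻¹ := Real.rpow_pos_of_pos hts _
    refine ofReal_mul_ball_le_lintegral hN (by positivity) hm ?_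
    filter_upwards [hu _ hσ0 (hσρ.trans hρR), ae_ne_zero hN] with y hy hy0 hyr
    have hy0' : 0 < ‖y‖ := norm_pos_iff.mpr hy0
    rw [hσ] at hy
    rw [hm_def, ENNReal.ofReal_mul (by positivity), ENNReal.ofReal_mul (by positivity)]
    have hkσ : k * ρ ≤ ε * s ^ θ⁻¹ := by
      rw [hk_def, mul_assoc]; exact mul_le_mul_of_nonneg_left hσk hε.le
    refine mul_le_mul' (mul_le_mul' (ENNReal.ofReal_le_ofReal ?_) (ENNReal.ofReal_le_ofReal ?_)) ?_
    · have h1 : ‖x - y‖ < η * (t - s) ^ θ⁻¹ := by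
        have h2 := norm_sub_le x y
        have h3 : ε * s ^ θ⁻¹ ≤ ε * ρ := mul_le_mul_of_nonneg_left hσρ.le hε.le
        have h4 : 2 * ε * ρ ≤ η * q * ρ := mul_le_mul_of_nonneg_right hεη hρ.le
        have hη : 0 ≤ η := by
          by_contra hη
          have : η * q < 0 := mul_neg_of_neg_of_pos (not_le.mp hη) hq
          linarith
        have h5 : η * (q * ρ) ≤ η * (t - s) ^ θ⁻¹ := mul_le_mul_of_nonneg_left hτk hη
        linarith
      have h6 := hG _ _ hτ0 h1
      rw [hτ] at h6
      refine le_trans ?_ h6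
      gcongr
    · exact Real.rpow_le_rpow_of_nonpos hy0' hyr.le (by linarith)
    · rw [← ENNReal.ofReal_rpow_of_nonneg (by positivity) (by linarith)]
      refine ENNReal.rpow_le_rpow ?_ (by linarith)
      refine le_trans (ENNReal.ofReal_le_ofReal ?_) (hy (hyr.trans_le hkσ))
      exact mul_le_mul_of_nonneg_left
        (Real.rpow_le_rpow_of_nonpos hσ0 hσρ.le (by linarith)) ha
  calc ENNReal.ofReal (c * k ^ (-γ) * k ^ N * v / 4 * a ^ p * ρ ^ (-β))
      = ENNReal.ofReal (m * ((k * ρ) ^ N * v)) * volume (Ioo (t / 4) (t / 2)) := by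
        rw [Real.volume_Ioo, ← ENNReal.ofReal_mul (by positivity)]
        congr 1
        have e : ρ ^ (-β) = ρ ^ (-γ) * (ρ ^ (-β)) ^ p * ρ ^ θ := by
          rw [← Real.rpow_mul hρ.le, ← Real.rpow_add hρ, ← Real.rpow_add hρ]
          congr 1; linarith
        rw [hm_def, Real.mul_rpow hk.le hρ.le, Real.mul_rpow ha (by positivity), mul_pow, ht_def]
        conv_lhs => rw [e]
        field_simp
        ring
    _ = ∫⁻ _ in Ioo (t / 4) (t / 2), ENNReal.ofReal (m * ((k * ρ) ^ N * v)) := by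
        rw [setLIntegral_const]
    _ ≤ ∫⁻ s in Ioo (t / 4) (t / 2), ∫⁻ y : EuclideanSpace ℝ (Fin N),
        ENNReal.ofReal (G N θ (x - y) (t - s)) * ENNReal.ofReal (‖y‖ ^ (-γ)) * u (y, s) ^ p :=
        setLIntegral_mono' measurableSet_Ioo hinner
    _ ≤ _ := lintegral_mono_set (Ioo_subset_Ioo (by linarith) (by linarith))

/-- Nonexistence for data above a large multiple of `‖x‖ ^ (-β)` near the origin. -/
theorem exists_not_hasLocalSolution (hN : 1 ≤ N) (hθ : 0 < θ) (hγ : 0 < γ) (hp : 1 < p)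
    (hβ : 0 ≤ β) (hscale : θ - γ - β * p = -β) :
    ∃ C : ℝ, 0 < C ∧ ∀ f : EuclideanSpace ℝ (Fin N) → ℝ, AEMeasurable f volume →
      (∃ δ : ℝ, 0 < δ ∧ ∀ᵐ x, ‖x‖ < δ → C * ‖x‖ ^ (-β) ≤ f x) →
        ¬ HasLocalSolution N θ γ p (toMeasure f) := by
  obtain ⟨η, c, hη, hc, hG⟩ := exists_le_G (N := N) hN hθ
  set v := volume.real (Metric.ball (0 : EuclideanSpace ℝ (Fin N)) 1)
  have hv : 0 < v :=
    ENNReal.toReal_pos (Metric.measure_ball_pos _ _ one_pos).ne' measure_ball_lt_top.ne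
  set q : ℝ := (1 / 4) ^ θ⁻¹
  have hq : 0 < q := Real.rpow_pos_of_pos (by norm_num) _
  have hq1 : q ≤ 1 := Real.rpow_le_one (by norm_num) (by norm_num) (by positivity)
  have hqθ : q ^ θ = 1 / 4 := by
    rw [← Real.rpow_mul (by norm_num), inv_mul_cancel₀ hθ.ne', Real.rpow_one]
  -- for `‖x‖, ‖y‖ < ε ρ` the difference `x - y` stays in the ball of radius `η q ρ`, on which the
  -- kernel is bounded below at all times between `ρ ^ θ / 4` and `ρ ^ θ`
  set ε := η * q / 2 with hε_def
  have hε : 0 < ε := by positivity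
  set c₁ := c * ε ^ (-β) * ε ^ N * v
  have hc₁ : 0 < c₁ := by positivity
  set c₂ := c * (ε * q) ^ (-γ) * (ε * q) ^ N * v / 4
  have hc₂ : 0 < c₂ := by positivity
  -- above the threshold `A`, one application of the Duhamel formula doubles the lower bound
  set A := (2 / c₂) ^ (p - 1)⁻¹
  have hA : 0 < A := Real.rpow_pos_of_pos (by positivity) _
  have hAp : c₂ * A ^ (p - 1) = 2 := by
    rw [← Real.rpow_mul (by positivity), inv_mul_cancel₀ (by linarith), Real.rpow_one]
    field_simp
  have hdouble : ∀ a, A ≤ a → 2 * a ≤ c₂ * a ^ p := fun a ha => by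
    have ha0 : 0 < a := hA.trans_le ha
    have e : a ^ p = a ^ (p - 1) * a := by
      rw [← Real.rpow_add_one ha0.ne']; congr 1; ring
    have h1 : A ^ (p - 1) ≤ a ^ (p - 1) := Real.rpow_le_rpow hA.le ha (by linarith)
    rw [e, ← mul_assoc]
    refine mul_le_mul_of_nonneg_right ?_ ha0.le
    rw [← hAp]
    exact mul_le_mul_of_nonneg_left h1 hc₂.le
  refine ⟨A / c₁, by positivity, ?_⟩
  rintro f hf ⟨δ, hδ, hfδ⟩ ⟨T, hT, u, hu⟩
  obtain ⟨T₀, hT₀, hT₀T⟩ := EReal.lt_iff_exists_real_btwn.mp hT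
  have hT₀' : 0 < T₀ := by exact_mod_cast hT₀
  set R := min (T₀ ^ θ⁻¹) (δ / ε)
  have hR : 0 < R := lt_min (Real.rpow_pos_of_pos hT₀' _) (by positivity)
  have htime : ∀ ρ, 0 < ρ → ρ < R → ((ρ ^ θ : ℝ) : EReal) < T := fun ρ hρ hρR => by
    refine lt_trans ?_ hT₀T
    have h1 : ρ ^ θ < (T₀ ^ θ⁻¹) ^ θ :=
      Real.rpow_lt_rpow hρ.le (hρR.trans_le (min_le_left _ _)) hθ
    rw [← Real.rpow_mul hT₀'.le, inv_mul_cancel₀ hθ.ne', Real.rpow_one] at h1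
    exact_mod_cast h1
  have hbound : ∀ n : ℕ, SelfSimilarLowerBound θ β ε R u (2 ^ n * A) := by
    intro n
    induction n with
    | zero =>
      intro ρ hρ hρR
      filter_upwards [hu.duhamel _ (Real.rpow_pos_of_pos hρ θ) (htime ρ hρ hρR)] with x hx hxρ
      rw [hx.2]
      refine le_trans ?_ le_self_add
      have hρδ : ε * ρ ≤ δ := by
        have := (hρR.trans_le (min_le_right _ _)).le
        rw [le_div_iff₀ hε] at this
        linarith
      have hεη : 2 * ε ≤ η := by
        have : η * q ≤ η * 1 := mul_le_mul_of_nonneg_left hq1 hη.le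
        rw [hε_def]; linarith
      refine le_trans (le_of_eq ?_) (lowerBound_linear hN hβ hc hε hεη (C := A / c₁)
        (by positivity) hρ hρδ hG hf hfδ hxρ)
      rw [show c * ε ^ (-β) * ε ^ N * v * (A / c₁) = A from mul_div_cancel₀ A hc₁.ne',
        pow_zero, one_mul]
    | succ n ih =>
      intro ρ hρ hρR
      filter_upwards [hu.duhamel _ (Real.rpow_pos_of_pos hρ θ) (htime ρ hρ hρR)] with x hx hxρ
      rw [hx.2]
      refine le_trans ?_ le_add_self
      refine le_trans (ENNReal.ofReal_le_ofReal ?_) (ih.duhamel hN hθ hγ hp hβ hscale hc hε hq hqθ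
        (by rw [hε_def]; linarith) (by positivity) hG hρ hρR hxρ)
      refine mul_le_mul_of_nonneg_right ?_ (by positivity)
      rw [pow_succ', mul_assoc]
      exact hdouble (2 ^ n * A) (le_mul_of_one_le_left hA.le (one_le_pow₀ (by norm_num)))
  have hρ : 0 < R / 2 := half_pos hR
  have hρR : R / 2 < R := half_lt_self hR
  have hfalse : ∀ᵐ x : EuclideanSpace ℝ (Fin N), ¬ ‖x‖ < ε * (R / 2) := by
    filter_upwards [hu.duhamel _ (Real.rpow_pos_of_pos hρ θ) (htime _ hρ hρR),
      ae_all_iff.mpr fun n => hbound n _ hρ hρR] with x hx hxn hlt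
    have hL : 0 < A * (R / 2) ^ (-β) := by positivity
    obtain ⟨n, hn⟩ := pow_unbounded_of_one_lt ((u (x, (R / 2) ^ θ)).toReal / (A * (R / 2) ^ (-β)))
      (show (1 : ℝ) < 2 by norm_num)
    rw [div_lt_iff₀ hL, ← mul_assoc] at hn
    have h1 := (ENNReal.ofReal_le_iff_le_toReal hx.1.ne).mp (hxn n hlt)
    linarith
  have hball : volume (Metric.ball (0 : EuclideanSpace ℝ (Fin N)) (ε * (R / 2))) = 0 := by
    refine measure_mono_null (fun x hx => ?_) (ae_iff.mp hfalse)
    simpa using hx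
  exact (Metric.measure_ball_pos volume (0 : EuclideanSpace ℝ (Fin N))
    (by positivity : 0 < ε * (R / 2))).ne' hball

end Nonexistence

/-! ### A self-similar supersolution -/

section Supersolution

variable {N : ℕ} {θ γ p β : ℝ}

lemma exists_lintegral_ball_norm_rpow_le (hN : 1 ≤ N) {b : ℝ} (hbN : b < N) :
    ∃ C : ℝ, 0 < C ∧ ∀ r : ℝ, 0 < r →
      ∫⁻ y in Metric.ball (0 : EuclideanSpace ℝ (Fin N)) r, ENNReal.ofReal (‖y‖ ^ (-b)) ≤
        ENNReal.ofReal (C * r ^ N * r ^ (-b)) := by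
  have : NeZero N := ⟨by omega⟩
  have hint : ∀ r : ℝ, 0 < r →
      IntegrableOn (fun y : EuclideanSpace ℝ (Fin N) => ‖y‖ ^ (-b)) (Metric.ball 0 r) := by
    intro r hr
    rw [integrableOn_fun_norm_addHaar volume (f := fun s : ℝ => s ^ (-b)), finrank_euclideanSpace_fin]
    have h1 : IntegrableOn (fun s : ℝ => s ^ ((N : ℝ) - 1 - b)) (Ioo 0 r) :=
      (intervalIntegral.integrableOn_Ioo_rpow_iff hr).mpr (by linarith)
    refine h1.congr_fun (fun s hs => ?_) measurableSet_Ioo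
    have hs0 : 0 < s := hs.1
    have : ((N - 1 : ℕ) : ℝ) = (N : ℝ) - 1 := by rw [Nat.cast_sub hN, Nat.cast_one]
    simp only [smul_eq_mul]
    rw [← Real.rpow_natCast, ← Real.rpow_add hs0, this]
    congr 1
  set I := ∫ y in Metric.ball (0 : EuclideanSpace ℝ (Fin N)) 1, ‖y‖ ^ (-b)
  have hI : 0 ≤ I := integral_nonneg fun y => Real.rpow_nonneg (norm_nonneg _) _
  refine ⟨I + 1, by positivity, fun r hr => ?_⟩
  rw [← ofReal_integral_eq_lintegral_ofReal (hint r hr)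
    (Eventually.of_forall fun y => Real.rpow_nonneg (norm_nonneg _) _)]
  refine ENNReal.ofReal_le_ofReal ?_
  have h2 := Measure.setIntegral_comp_smul_of_pos (volume : Measure (EuclideanSpace ℝ (Fin N)))
    (fun y => ‖y‖ ^ (-b)) (Metric.ball 0 1) hr
  rw [smul_unitBall_of_pos hr, finrank_euclideanSpace_fin, smul_eq_mul] at h2
  have h3 : ∀ y : EuclideanSpace ℝ (Fin N), ‖r • y‖ ^ (-b) = r ^ (-b) * ‖y‖ ^ (-b) := fun y => by
    rw [norm_smul, Real.norm_of_nonneg hr.le, Real.mul_rpow hr.le (norm_nonneg _)]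
  simp only [h3] at h2
  rw [integral_const_mul] at h2
  have h4 : ∫ y in Metric.ball (0 : EuclideanSpace ℝ (Fin N)) r, ‖y‖ ^ (-b) =
      r ^ N * (r ^ (-b) * I) := by
    rw [h2]; field_simp
  rw [h4]
  have : 0 ≤ r ^ N * r ^ (-b) := by positivity
  nlinarith

/-- The heat kernel acting on `‖y‖ ^ (-b)`. Outside the ball of radius `r` the weight is at most
`r ^ (-b)` and the kernel has mass at most one; inside, the kernel is at most a multiple of
`r ^ (-N)`. -/
lemma exists_lintegral_G_mul_norm_rpow_le (hN : 1 ≤ N) (hθ : 0 < θ) (hθ2 : θ ≤ 2) {b : ℝ}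
    (hb : 0 ≤ b) (hbN : b < N) :
    ∃ C : ℝ, 0 < C ∧ ∀ (t r : ℝ) (x : EuclideanSpace ℝ (Fin N)), 0 < t → 0 < r →
      (2 * r ≤ ‖x‖ ∨ r ≤ t ^ θ⁻¹) →
      ∫⁻ y, ENNReal.ofReal (G N θ (x - y) t) * ENNReal.ofReal (‖y‖ ^ (-b)) ≤
        ENNReal.ofReal (C * r ^ (-b)) := by
  obtain ⟨C₁, hC₁, h1⟩ := exists_lintegral_ball_norm_rpow_le hN hbN
  obtain ⟨C₂, hC₂, h2⟩ := exists_G_le hN hθ hθ2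
  refine ⟨C₂ * C₁ + 1, by positivity, fun t r x ht hr hxr => ?_⟩
  have hroot : (t ^ θ⁻¹) ^ θ = t := by
    rw [← Real.rpow_mul ht.le, inv_mul_cancel₀ hθ.ne', Real.rpow_one]
  have hG := isRadialSubprob_G hN hθ hθ2 ht
  have hGm : Measurable fun y => ENNReal.ofReal (G N θ (x - y) t) :=
    (hG.measurable.comp (measurable_const.sub measurable_id)).ennreal_ofReal
  have hwm : Measurable fun y : EuclideanSpace ℝ (Fin N) => ENNReal.ofReal (‖y‖ ^ (-b)) := by
    fun_prop
  have hpt : ∀ y : EuclideanSpace ℝ (Fin N),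
      ENNReal.ofReal (G N θ (x - y) t) * ENNReal.ofReal (‖y‖ ^ (-b)) ≤
        ENNReal.ofReal (C₂ * (r ^ N)⁻¹) *
          (Metric.ball 0 r).indicator (fun y => ENNReal.ofReal (‖y‖ ^ (-b))) y +
        ENNReal.ofReal (G N θ (x - y) t) * ENNReal.ofReal (r ^ (-b)) := by
    intro y
    by_cases hy : ‖y‖ < r
    · rw [indicator_of_mem (mem_ball_zero_iff.mpr hy)]
      refine le_trans ?_ le_self_add
      gcongr
      have h3 := h2 (t ^ θ⁻¹) r (x - y) (by positivity) hr (hxr.imp_left fun h => by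
        have := norm_sub_norm_le x y
        linarith)
      rwa [hroot] at h3
    · refine le_trans ?_ le_add_self
      exact mul_le_mul' le_rfl (ENNReal.ofReal_le_ofReal
        (Real.rpow_le_rpow_of_nonpos hr (not_lt.mp hy) (by linarith)))
  refine (lintegral_mono hpt).trans ?_
  rw [lintegral_add_right _ (hGm.mul_const _),
    lintegral_const_mul _ (hwm.indicator Metric.isOpen_ball.measurableSet),
    lintegral_indicator Metric.isOpen_ball.measurableSet, lintegral_mul_const _ hGm,
    lintegral_sub_left_eq_self (fun z => ENNReal.ofReal (G N θ z t)) x]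
  calc ENNReal.ofReal (C₂ * (r ^ N)⁻¹) *
        (∫⁻ y in Metric.ball (0 : EuclideanSpace ℝ (Fin N)) r, ENNReal.ofReal (‖y‖ ^ (-b))) +
        (∫⁻ y, ENNReal.ofReal (G N θ y t)) * ENNReal.ofReal (r ^ (-b))
      ≤ ENNReal.ofReal (C₂ * (r ^ N)⁻¹) * ENNReal.ofReal (C₁ * r ^ N * r ^ (-b)) +
        1 * ENNReal.ofReal (r ^ (-b)) := by
        gcongr
        · exact h1 r hr
        · exact hG.lintegral_le
    _ = ENNReal.ofReal ((C₂ * C₁ + 1) * r ^ (-b)) := by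
        rw [one_mul, ← ENNReal.ofReal_mul (by positivity), ← ENNReal.ofReal_add (by positivity)
          (by positivity)]
        congr 1
        field_simp

/-- The self-similar profile `(max ‖x‖ (t ^ (1/θ))) ^ (-β)`, comparable to the linear evolution of
`‖x‖ ^ (-β)`. -/
noncomputable def profile (θ β : ℝ) (x : EuclideanSpace ℝ (Fin N)) (t : ℝ) : ℝ :=
  (max ‖x‖ (t ^ θ⁻¹)) ^ (-β)

lemma profile_nonneg {x : EuclideanSpace ℝ (Fin N)} {t : ℝ} : 0 ≤ profile θ β x t :=
  Real.rpow_nonneg (le_max_of_le_left (norm_nonneg _)) _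

lemma exists_linear_le_profile (hN : 1 ≤ N) (hθ : 0 < θ) (hθ2 : θ ≤ 2) (hβ : 0 ≤ β)
    (hβN : β < N) :
    ∃ C : ℝ, 0 < C ∧ ∀ (t : ℝ) (x : EuclideanSpace ℝ (Fin N)), 0 < t →
      ∫⁻ y, ENNReal.ofReal (G N θ (x - y) t) * ENNReal.ofReal (‖y‖ ^ (-β)) ≤
        ENNReal.ofReal (C * profile θ β x t) := by
  obtain ⟨C, hC, h⟩ := exists_lintegral_G_mul_norm_rpow_le hN hθ hθ2 hβ hβN
  refine ⟨C * (1 / 2) ^ (-β), by positivity, fun t x ht => ?_⟩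
  have hρ : 0 < t ^ θ⁻¹ := Real.rpow_pos_of_pos ht _
  have hM : 0 < max ‖x‖ (t ^ θ⁻¹) := lt_max_of_lt_right hρ
  have h1 := h t (1 / 2 * max ‖x‖ (t ^ θ⁻¹)) x ht (by positivity) (by
    rcases le_total ‖x‖ (t ^ θ⁻¹) with h2 | h2
    · right; rw [max_eq_right h2]; linarith
    · left; rw [max_eq_left h2]; linarith)
  rwa [Real.mul_rpow (by norm_num) hM.le, ← mul_assoc] at h1

lemma lintegral_Ioo_rpow {κ T : ℝ} (hκ : 0 < κ) (hT : 0 < T) :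
    ∫⁻ s in Ioo 0 T, ENNReal.ofReal (s ^ (κ - 1)) = ENNReal.ofReal (T ^ κ / κ) := by
  have hi := (intervalIntegral.integrableOn_Ioo_rpow_iff (s := κ - 1) hT).mpr (by linarith)
  rw [← ofReal_integral_eq_lintegral_ofReal hi]
  · rw [← integral_Ioc_eq_integral_Ioo, ← intervalIntegral.integral_of_le hT.le,
      integral_rpow (Or.inl (by linarith)), sub_add_cancel, Real.zero_rpow hκ.ne', sub_zero]
  · exact (ae_restrict_iff' measurableSet_Ioo).mpr
      (Eventually.of_forall fun s hs => Real.rpow_nonneg hs.1.le _)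

lemma lintegral_Ico_sub_rpow_le {κ t : ℝ} (hκ : 0 < κ) (ht : 0 < t) :
    ∫⁻ s in Ico (t / 2) t, ENNReal.ofReal ((t - s) ^ (κ - 1)) ≤
      ENNReal.ofReal ((t / 2) ^ κ / κ) := by
  rw [← lintegral_Ioo_rpow hκ (half_pos ht), ← lintegral_indicator measurableSet_Ioo,
    ← lintegral_sub_left_eq_self
      ((Ioo 0 (t / 2)).indicator fun s => ENNReal.ofReal (s ^ (κ - 1))) t, ← restrict_Ioo_eq_restrict_Ico,
    ← lintegral_indicator measurableSet_Ioo]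
  refine lintegral_mono fun s => ?_
  by_cases hs : s ∈ Ioo (t / 2) t
  · rw [indicator_of_mem hs, indicator_of_mem
      (show t - s ∈ Ioo 0 (t / 2) from ⟨by linarith [hs.2], by linarith [hs.1]⟩)]
  · rw [indicator_of_notMem hs]
    exact zero_le

/-- Interpolation between the two bounds for the profile: the nonlinearity trades powers of `‖y‖`
for powers of `s ^ (1/θ)`. -/
lemma norm_rpow_mul_profile_rpow_le (hθ : 0 < θ) (hγ : 0 < γ)
    (hscale : θ - γ - β * p = -β) {b : ℝ} (hγb : γ ≤ b) (hb : b ≤ β + θ)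
    (y : EuclideanSpace ℝ (Fin N)) {s : ℝ} (hs : 0 < s) :
    ‖y‖ ^ (-γ) * profile θ β y s ^ p ≤ ‖y‖ ^ (-b) * s ^ ((b - β) / θ - 1) := by
  have hσ : 0 < s ^ θ⁻¹ := Real.rpow_pos_of_pos hs _
  have hM : 0 < max ‖y‖ (s ^ θ⁻¹) := lt_max_of_lt_right hσ
  rcases eq_or_ne y 0 with rfl | hy
  -- at the origin the singular weight has the junk value `0 ^ (-γ) = 0`
  · rw [norm_zero, Real.zero_rpow (by linarith), zero_mul]
    positivity
  have hy' : 0 < ‖y‖ := norm_pos_iff.mpr hy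
  have e1 : profile θ β y s ^ p =
      max ‖y‖ (s ^ θ⁻¹) ^ (-(b - γ)) * max ‖y‖ (s ^ θ⁻¹) ^ (-(β + θ - b)) := by
    rw [profile, ← Real.rpow_mul hM.le, ← Real.rpow_add hM]
    congr 1; linarith
  have e2 : s ^ ((b - β) / θ - 1) = (s ^ θ⁻¹) ^ (-(β + θ - b)) := by
    rw [← Real.rpow_mul hs.le]
    congr 1; field_simp; ring
  have e3 : ‖y‖ ^ (-b) = ‖y‖ ^ (-γ) * ‖y‖ ^ (-(b - γ)) := by
    rw [← Real.rpow_add hy']; congr 1; ring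
  rw [e1, e2, e3, ← mul_assoc]
  have h1 := Real.rpow_le_rpow_of_nonpos hy' (le_max_left ‖y‖ (s ^ θ⁻¹))
    (show -(b - γ) ≤ 0 by linarith)
  have h2 := Real.rpow_le_rpow_of_nonpos hσ (le_max_right ‖y‖ (s ^ θ⁻¹))
    (show -(β + θ - b) ≤ 0 by linarith)
  gcongr

lemma exists_lintegral_space_le (hN : 1 ≤ N) (hθ : 0 < θ) (hθ2 : θ ≤ 2) (hγ : 0 < γ) (hp : 0 < p)
    (hscale : θ - γ - β * p = -β) {b : ℝ} (hγb : γ ≤ b) (hb : b ≤ β + θ)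
    (hbN : b < N) :
    ∃ C : ℝ, 0 < C ∧ ∀ (t s r : ℝ) (x : EuclideanSpace ℝ (Fin N)), 0 < s → s < t → 0 < r →
      (2 * r ≤ ‖x‖ ∨ r ≤ (t - s) ^ θ⁻¹) →
      ∫⁻ y, ENNReal.ofReal (G N θ (x - y) (t - s)) * ENNReal.ofReal (‖y‖ ^ (-γ)) *
          ENNReal.ofReal (profile θ β y s) ^ p ≤
        ENNReal.ofReal (C * r ^ (-b)) * ENNReal.ofReal (s ^ ((b - β) / θ - 1)) := by
  obtain ⟨C, hC, h⟩ := exists_lintegral_G_mul_norm_rpow_le hN hθ hθ2 (hγ.le.trans hγb) hbN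
  refine ⟨C, hC, fun t s r x hs hst hr hxr => ?_⟩
  refine le_trans (lintegral_mono (g := fun y => ENNReal.ofReal (s ^ ((b - β) / θ - 1)) *
    (ENNReal.ofReal (G N θ (x - y) (t - s)) * ENNReal.ofReal (‖y‖ ^ (-b)))) fun y => ?_) ?_
  · rw [ENNReal.ofReal_rpow_of_nonneg profile_nonneg hp.le, mul_assoc,
      ← ENNReal.ofReal_mul (show 0 ≤ ‖y‖ ^ (-γ) by positivity)]
    refine le_of_le_of_eq ?_ (mul_left_comm _ _ _)
    refine mul_le_mul' le_rfl ?_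
    rw [← ENNReal.ofReal_mul (by positivity), mul_comm (s ^ _)]
    exact ENNReal.ofReal_le_ofReal
      (norm_rpow_mul_profile_rpow_le hθ hγ hscale hγb hb y hs)
  · rw [lintegral_const_mul' _ _ ENNReal.ofReal_ne_top, mul_comm]
    gcongr
    exact h (t - s) r x (sub_pos.mpr hst) hr hxr

/-- The Duhamel term of the profile is bounded by the profile. The exponent `b > β` gives
integrability at `s = 0`; near `s = t` and for small `‖x‖` the exponent `γ < θ` is used instead. -/
lemma exists_duhamel_le_profile (hN : 1 ≤ N) (hθ : 0 < θ) (hθ2 : θ ≤ 2) (hγ : 0 < γ) (hp : 0 < p)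
    (hγθ : γ < θ) (hγN : γ < N) (hβ : 0 ≤ β) (hβN : β < N) (hscale : θ - γ - β * p = -β) :
    ∃ C : ℝ, 0 < C ∧ ∀ (t : ℝ) (x : EuclideanSpace ℝ (Fin N)), 0 < t →
      ∫⁻ s in Ioo 0 t, ∫⁻ y, ENNReal.ofReal (G N θ (x - y) (t - s)) *
          ENNReal.ofReal (‖y‖ ^ (-γ)) * ENNReal.ofReal (profile θ β y s) ^ p ≤
        ENNReal.ofReal (C * profile θ β x t) := by
  -- `b ≥ γ` and `b ≤ β + θ` permit the interpolation, `b < N` the kernel estimate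
  obtain ⟨b, hb1, hb2⟩ : ∃ b, max β γ < b ∧ b < min (N : ℝ) (β + θ) := exists_between
    (max_lt (lt_min hβN (by linarith)) (lt_min hγN (by linarith)))
  obtain ⟨hβb, hγb⟩ := max_lt_iff.mp hb1
  obtain ⟨hbN, hbβ⟩ := lt_min_iff.mp hb2
  obtain ⟨C₁, hC₁, h1⟩ := exists_lintegral_space_le hN hθ hθ2 hγ hp hscale hγb.le hbβ.le hbN
  obtain ⟨C₂, hC₂, h2⟩ := exists_lintegral_space_le hN hθ hθ2 hγ hp hscale le_rfl
    (by linarith : γ ≤ β + θ) hγN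
  set κ := (b - β) / θ
  have hκ : 0 < κ := div_pos (by linarith) hθ
  set μ := 1 - γ / θ
  have hμ : 0 < μ := sub_pos.mpr ((div_lt_one hθ).mpr hγθ)
  set D₁ := C₁ * (1 / 2) ^ (-b) / κ
  have hD₁ : 0 < D₁ := by positivity
  set D₂ := (C₁ / κ + C₂ / μ) * (1 / 2) ^ (-(β / θ))
  have hD₂ : 0 < D₂ := by positivity
  refine ⟨D₁ + D₂, by positivity, fun t x ht => ?_⟩
  set ρ := t ^ θ⁻¹
  have hρ : 0 < ρ := Real.rpow_pos_of_pos ht _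
  have hP : 0 ≤ profile θ β x t := profile_nonneg
  rcases le_total ρ ‖x‖ with hx | hx
  · have hx0 : 0 < ‖x‖ := hρ.trans_le hx
    calc ∫⁻ s in Ioo 0 t, ∫⁻ y, ENNReal.ofReal (G N θ (x - y) (t - s)) *
          ENNReal.ofReal (‖y‖ ^ (-γ)) * ENNReal.ofReal (profile θ β y s) ^ p
        ≤ ∫⁻ s in Ioo 0 t, ENNReal.ofReal (C₁ * (1 / 2 * ‖x‖) ^ (-b)) *
          ENNReal.ofReal (s ^ (κ - 1)) := by
          refine setLIntegral_mono' measurableSet_Ioo fun s hs => ?_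
          exact h1 t s _ x hs.1 hs.2 (by positivity) (Or.inl (by linarith))
      _ = ENNReal.ofReal (C₁ * (1 / 2 * ‖x‖) ^ (-b) * (t ^ κ / κ)) := by
          rw [lintegral_const_mul' _ _ ENNReal.ofReal_ne_top, lintegral_Ioo_rpow hκ ht,
            ← ENNReal.ofReal_mul (by positivity)]
      _ ≤ ENNReal.ofReal ((D₁ + D₂) * profile θ β x t) := by
          refine ENNReal.ofReal_le_ofReal ?_
          have e1 : t ^ κ = ρ ^ (b - β) := by
            rw [← Real.rpow_mul ht.le]; congr 1; simp only [κ]; field_simp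
          have e2 : profile θ β x t = ‖x‖ ^ (-b) * ‖x‖ ^ (b - β) := by
            rw [profile, max_eq_left hx, ← Real.rpow_add hx0]; congr 1; ring
          have h3 : ρ ^ (b - β) ≤ ‖x‖ ^ (b - β) := Real.rpow_le_rpow hρ.le hx (by linarith)
          calc C₁ * (1 / 2 * ‖x‖) ^ (-b) * (t ^ κ / κ)
              = D₁ * (‖x‖ ^ (-b) * ρ ^ (b - β)) := by
                rw [Real.mul_rpow (by norm_num) hx0.le, e1]; simp only [D₁]; ring
            _ ≤ D₁ * profile θ β x t := by rw [e2]; gcongr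
            _ ≤ (D₁ + D₂) * profile θ β x t := by
                have := mul_nonneg hD₂.le hP
                linarith
  · have ht2 : 0 < t / 2 := half_pos ht
    have hr : 0 < (t / 2) ^ θ⁻¹ := Real.rpow_pos_of_pos ht2 _
    have hfirst : ∫⁻ s in Ioo 0 (t / 2), ∫⁻ y, ENNReal.ofReal (G N θ (x - y) (t - s)) *
        ENNReal.ofReal (‖y‖ ^ (-γ)) * ENNReal.ofReal (profile θ β y s) ^ p ≤
          ENNReal.ofReal (C₁ / κ * (t / 2) ^ (-(β / θ))) := by
      calc _ ≤ ∫⁻ s in Ioo 0 (t / 2), ENNReal.ofReal (C₁ * ((t / 2) ^ θ⁻¹) ^ (-b)) *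
            ENNReal.ofReal (s ^ (κ - 1)) := by
            refine setLIntegral_mono' measurableSet_Ioo fun s hs => ?_
            exact h1 t s _ x hs.1 (by linarith [hs.2]) hr (Or.inr (Real.rpow_le_rpow ht2.le
              (by linarith [hs.2]) (by positivity)))
        _ = ENNReal.ofReal (C₁ * ((t / 2) ^ θ⁻¹) ^ (-b) * ((t / 2) ^ κ / κ)) := by
            rw [lintegral_const_mul' _ _ ENNReal.ofReal_ne_top, lintegral_Ioo_rpow hκ ht2,
              ← ENNReal.ofReal_mul (by positivity)]
        _ = _ := by
            have e : (t / 2) ^ (-(β / θ)) = ((t / 2) ^ θ⁻¹) ^ (-b) * (t / 2) ^ κ := by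
              rw [← Real.rpow_mul ht2.le, ← Real.rpow_add ht2]
              congr 1; simp only [κ]; field_simp; ring
            rw [e]; congr 1; ring
    have hsecond : ∫⁻ s in Ico (t / 2) t, ∫⁻ y, ENNReal.ofReal (G N θ (x - y) (t - s)) *
        ENNReal.ofReal (‖y‖ ^ (-γ)) * ENNReal.ofReal (profile θ β y s) ^ p ≤
          ENNReal.ofReal (C₂ / μ * (t / 2) ^ (-(β / θ))) := by
      have hexp : (γ - β) / θ - 1 ≤ 0 := by
        have : (γ - β) / θ < 1 := (div_lt_one hθ).mpr (by linarith)
        linarith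
      calc _ ≤ ∫⁻ s in Ico (t / 2) t, ENNReal.ofReal (C₂ * (t / 2) ^ ((γ - β) / θ - 1)) *
            ENNReal.ofReal ((t - s) ^ (μ - 1)) := by
            refine setLIntegral_mono' measurableSet_Ico fun s hs => ?_
            have hs0 : 0 < s := ht2.trans_le hs.1
            have hts : 0 < t - s := sub_pos.mpr hs.2
            refine (h2 t s ((t - s) ^ θ⁻¹) x hs0 hs.2 (by positivity) (Or.inr le_rfl)).trans ?_
            rw [← ENNReal.ofReal_mul (by positivity), ← ENNReal.ofReal_mul (by positivity)]
            refine ENNReal.ofReal_le_ofReal ?_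
            have e : ((t - s) ^ θ⁻¹) ^ (-γ) = (t - s) ^ (μ - 1) := by
              rw [← Real.rpow_mul hts.le]; congr 1; simp only [μ]; ring
            have h3 := Real.rpow_le_rpow_of_nonpos ht2 hs.1 hexp
            rw [e, mul_right_comm]
            gcongr
        _ ≤ ENNReal.ofReal (C₂ * (t / 2) ^ ((γ - β) / θ - 1)) *
            ENNReal.ofReal ((t / 2) ^ μ / μ) := by
            rw [lintegral_const_mul' _ _ ENNReal.ofReal_ne_top]
            gcongr
            exact lintegral_Ico_sub_rpow_le hμ ht
        _ = _ := by
            have e : (t / 2) ^ (-(β / θ)) = (t / 2) ^ ((γ - β) / θ - 1) * (t / 2) ^ μ := by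
              rw [← Real.rpow_add ht2]; congr 1; simp only [μ]; ring
            rw [← ENNReal.ofReal_mul (by positivity), e]; congr 1; ring
    have hsub : Ioo 0 t ⊆ Ioo 0 (t / 2) ∪ Ico (t / 2) t := fun s hs =>
      (lt_or_ge s (t / 2)).imp (fun h => ⟨hs.1, h⟩) fun h => ⟨h, hs.2⟩
    refine (lintegral_mono_set hsub).trans ((lintegral_union_le _ _ _).trans
      ((add_le_add hfirst hsecond).trans ?_))
    rw [← ENNReal.ofReal_add (by positivity) (by positivity)]
    refine ENNReal.ofReal_le_ofReal ?_
    have e : (t / 2) ^ (-(β / θ)) = (1 / 2) ^ (-(β / θ)) * profile θ β x t := by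
      rw [profile, max_eq_right hx, ← Real.rpow_mul ht.le, div_eq_mul_one_div t 2,
        Real.mul_rpow ht.le (by norm_num), mul_comm]
      congr 2; ring
    calc C₁ / κ * (t / 2) ^ (-(β / θ)) + C₂ / μ * (t / 2) ^ (-(β / θ))
        = D₂ * profile θ β x t := by rw [e]; simp only [D₂]; ring
      _ ≤ (D₁ + D₂) * profile θ β x t := by
          have := mul_nonneg hD₁.le hP
          linarith

end Supersolution

/-! ### Solutions by monotone iteration -/

section MonotoneIteration

variable {N : ℕ} {θ γ p : ℝ}

/-- The right-hand side of the Duhamel formula, as an operator on functions of space and time. -/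
noncomputable def duhamelMap (θ γ p : ℝ) (μ : Measure (EuclideanSpace ℝ (Fin N)))
    (u : EuclideanSpace ℝ (Fin N) × ℝ → ℝ≥0∞) (z : EuclideanSpace ℝ (Fin N) × ℝ) : ℝ≥0∞ :=
  (∫⁻ y, ENNReal.ofReal (G N θ (z.1 - y) z.2) ∂μ) +
    ∫⁻ s in Ioo 0 z.2, ∫⁻ y : EuclideanSpace ℝ (Fin N),
      ENNReal.ofReal (G N θ (z.1 - y) (z.2 - s)) * ENNReal.ofReal (‖y‖ ^ (-γ)) * u (y, s) ^ p

lemma measurable_integrand {u : EuclideanSpace ℝ (Fin N) × ℝ → ℝ≥0∞} (hu : Measurable u) :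
    Measurable fun w : ((EuclideanSpace ℝ (Fin N) × ℝ) × ℝ) × EuclideanSpace ℝ (Fin N) =>
      ENNReal.ofReal (G N θ (w.1.1.1 - w.2) (w.1.1.2 - w.1.2)) * ENNReal.ofReal (‖w.2‖ ^ (-γ)) *
        u (w.2, w.1.2) ^ p := by
  have hG : Measurable fun w : ((EuclideanSpace ℝ (Fin N) × ℝ) × ℝ) × EuclideanSpace ℝ (Fin N) =>
      ENNReal.ofReal (G N θ (w.1.1.1 - w.2) (w.1.1.2 - w.1.2)) :=
    (measurable_G.comp (by fun_prop : Measurable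
      fun w : ((EuclideanSpace ℝ (Fin N) × ℝ) × ℝ) × EuclideanSpace ℝ (Fin N) =>
        (w.1.1.1 - w.2, w.1.1.2 - w.1.2))).ennreal_ofReal
  have hw : Measurable fun w : ((EuclideanSpace ℝ (Fin N) × ℝ) × ℝ) × EuclideanSpace ℝ (Fin N) =>
      ENNReal.ofReal (‖w.2‖ ^ (-γ)) := by fun_prop
  exact (hG.mul hw).mul
    ((hu.comp (measurable_snd.prodMk (measurable_snd.comp measurable_fst))).pow_const p)

lemma measurable_duhamelMap {μ : Measure (EuclideanSpace ℝ (Fin N))} [SFinite μ]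
    {u : EuclideanSpace ℝ (Fin N) × ℝ → ℝ≥0∞} (hu : Measurable u) :
    Measurable (duhamelMap θ γ p μ u) := by
  unfold duhamelMap
  refine Measurable.add ?_ ?_
  · refine Measurable.lintegral_prod_right'
      (f := fun w : (EuclideanSpace ℝ (Fin N) × ℝ) × EuclideanSpace ℝ (Fin N) =>
        ENNReal.ofReal (G N θ (w.1.1 - w.2) w.1.2)) ?_
    exact (measurable_G.comp (by fun_prop : Measurable
      fun w : (EuclideanSpace ℝ (Fin N) × ℝ) × EuclideanSpace ℝ (Fin N) =>
        (w.1.1 - w.2, w.1.2))).ennreal_ofReal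
  · have hin := (measurable_integrand (θ := θ) (γ := γ) (p := p) hu).lintegral_prod_right'
      (ν := volume)
    have hset : MeasurableSet {w : (EuclideanSpace ℝ (Fin N) × ℝ) × ℝ | 0 < w.2 ∧ w.2 < w.1.2} :=
      (measurableSet_lt measurable_const measurable_snd).inter
        (measurableSet_lt measurable_snd (measurable_snd.comp measurable_fst))
    have h := (hin.indicator hset).lintegral_prod_right' (ν := volume)
    convert h using 2 with z
    rw [← lintegral_indicator measurableSet_Ioo]
    refine lintegral_congr fun s => ?_
    simp only [indicator, mem_Ioo, mem_ofPred_eq]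

lemma duhamelMap_iSup {μ : Measure (EuclideanSpace ℝ (Fin N))} (hp : 0 < p)
    {U : ℕ → EuclideanSpace ℝ (Fin N) × ℝ → ℝ≥0∞} (hUm : ∀ n, Measurable (U n)) (hU : Monotone U)
    (z : EuclideanSpace ℝ (Fin N) × ℝ) :
    duhamelMap θ γ p μ (fun z => ⨆ n, U n z) z = ⨆ n, duhamelMap θ γ p μ (U n) z := by
  have hle : ∀ m n, m ≤ n → ∀ s y, ENNReal.ofReal (G N θ (z.1 - y) (z.2 - s)) *
      ENNReal.ofReal (‖y‖ ^ (-γ)) * U m (y, s) ^ p ≤ ENNReal.ofReal (G N θ (z.1 - y) (z.2 - s)) *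
      ENNReal.ofReal (‖y‖ ^ (-γ)) * U n (y, s) ^ p := fun m n hmn s y =>
    mul_le_mul' le_rfl (ENNReal.rpow_le_rpow (hU hmn _) hp.le)
  have hm : ∀ n s, Measurable fun y => ENNReal.ofReal (G N θ (z.1 - y) (z.2 - s)) *
      ENNReal.ofReal (‖y‖ ^ (-γ)) * U n (y, s) ^ p := fun n s => by
    have h := (measurable_integrand (θ := θ) (γ := γ) (p := p) (hUm n)).comp
      (measurable_prodMk_left (x := (z, s)))
    simpa only [Function.comp_def] using h
  have hm' : ∀ n, Measurable fun s => ∫⁻ y, ENNReal.ofReal (G N θ (z.1 - y) (z.2 - s)) *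
      ENNReal.ofReal (‖y‖ ^ (-γ)) * U n (y, s) ^ p := fun n => by
    have h := ((measurable_integrand (θ := θ) (γ := γ) (p := p) (hUm n)).lintegral_prod_right'
      (ν := volume)).comp (measurable_prodMk_left (x := z))
    simpa only [Function.comp_def] using h
  have hpow : ∀ s y, ENNReal.ofReal (G N θ (z.1 - y) (z.2 - s)) * ENNReal.ofReal (‖y‖ ^ (-γ)) *
      (⨆ n, U n (y, s)) ^ p = ⨆ n, ENNReal.ofReal (G N θ (z.1 - y) (z.2 - s)) *
        ENNReal.ofReal (‖y‖ ^ (-γ)) * U n (y, s) ^ p := fun s y => by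
    rw [← ENNReal.mul_iSup]
    congr 1
    exact (ENNReal.orderIsoRpow p hp).map_iSup _
  simp only [duhamelMap, ← ENNReal.add_iSup, hpow]
  congr 1
  rw [← lintegral_iSup hm' fun m n hmn s => lintegral_mono fun y => hle m n hmn s y]
  refine lintegral_congr fun s => ?_
  exact lintegral_iSup (fun n => hm n s) fun m n hmn y => hle m n hmn s y

/-- A finite supersolution of the Duhamel formula yields a global solution, as the supremum of the
iterates of `duhamelMap` started at zero. -/
lemma hasLocalSolution_of_supersolution {μ : Measure (EuclideanSpace ℝ (Fin N))} [SFinite μ]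
    (hp : 0 < p) {w : EuclideanSpace ℝ (Fin N) × ℝ → ℝ≥0∞}
    (hw : ∀ (x : EuclideanSpace ℝ (Fin N)) (t : ℝ), 0 < t → w (x, t) < ∞)
    (hle : ∀ (x : EuclideanSpace ℝ (Fin N)) (t : ℝ), 0 < t →
      duhamelMap θ γ p μ w (x, t) ≤ w (x, t)) :
    HasLocalSolution N θ γ p μ := by
  set U : ℕ → EuclideanSpace ℝ (Fin N) × ℝ → ℝ≥0∞ := fun n => (duhamelMap θ γ p μ)^[n] 0
  have hU : ∀ n, U (n + 1) = duhamelMap θ γ p μ (U n) := fun n =>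
    Function.iterate_succ_apply' _ _ _
  have hUm : ∀ n, Measurable (U n) := fun n => by
    induction n with
    | zero => exact measurable_zero
    | succ n ih => rw [hU]; exact measurable_duhamelMap ih
  have hmono : Monotone U := by
    refine monotone_nat_of_le_succ fun n => ?_
    induction n with
    | zero => exact fun z => zero_le
    | succ n ih =>
      rw [hU, hU]
      intro z
      unfold duhamelMap
      gcongr
      exact ih _
  have hUw : ∀ n x t, 0 < t → U n (x, t) ≤ w (x, t) := fun n => by
    induction n with
    | zero => exact fun x t _ => zero_le
    | succ n ih =>
      intro x t ht
      rw [hU]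
      refine le_trans ?_ (hle x t ht)
      unfold duhamelMap
      refine add_le_add_right (setLIntegral_mono' measurableSet_Ioo fun s hs => ?_) _
      refine lintegral_mono fun y => ?_
      gcongr
      exact ih y s hs.1
  refine ⟨⊤, by simp, fun z => ⨆ n, U n z, (Measurable.iSup hUm).aemeasurable, fun t ht _ => ?_⟩
  refine Eventually.of_forall fun x => ⟨(iSup_le fun n => hUw n x t ht).trans_lt (hw x t ht), ?_⟩
  have hshift : ⨆ n, U n (x, t) = ⨆ n, U (n + 1) (x, t) :=
    (Monotone.iSup_nat_add (f := fun n => U n (x, t)) (fun m n hmn => hmono hmn _) 1).symm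
  have h := duhamelMap_iSup (θ := θ) (γ := γ) (μ := μ) hp hUm hmono (x, t)
  simp only [← hU, ← hshift] at h
  exact h.symm

end MonotoneIteration

/-! ### Existence for small singular data and conclusion -/

/-- Existence for data below a small multiple of `‖x‖ ^ (-β)`. -/
theorem exists_hasLocalSolution {N : ℕ} {θ γ p β : ℝ} (hN : 1 ≤ N) (hθ : 0 < θ) (hθ2 : θ ≤ 2)
    (hγ : 0 < γ) (hp : 1 < p) (hγθ : γ < θ) (hγN : γ < N) (hβ : 0 ≤ β) (hβN : β < N)
    (hscale : θ - γ - β * p = -β) :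
    ∃ c : ℝ, 0 < c ∧ ∀ f : EuclideanSpace ℝ (Fin N) → ℝ, AEMeasurable f volume →
      (∀ᵐ x, f x ≤ c * ‖x‖ ^ (-β)) → HasLocalSolution N θ γ p (toMeasure f) := by
  obtain ⟨C₁, hC₁, h1⟩ := exists_linear_le_profile hN hθ hθ2 hβ hβN
  obtain ⟨C₂, hC₂, h2⟩ := exists_duhamel_le_profile hN hθ hθ2 hγ (by linarith) hγθ hγN hβ hβN hscale
  -- `A` and `c = A / (2 C₁)` solve `c C₁ + A ^ p C₂ = A`, so that `A` times the profile is a supersolution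
  set A := (1 / (2 * C₂)) ^ (p - 1)⁻¹
  have hA : 0 < A := Real.rpow_pos_of_pos (by positivity) _
  have hAp : A ^ p * C₂ = A / 2 := by
    have e1 : A ^ p = A ^ (p - 1) * A := by
      rw [← Real.rpow_add_one hA.ne']; congr 1; ring
    have e2 : A ^ (p - 1) = 1 / (2 * C₂) := by
      rw [← Real.rpow_mul (by positivity), inv_mul_cancel₀ (by linarith), Real.rpow_one]
    rw [e1, e2]; field_simp
  refine ⟨A / (2 * C₁), by positivity, fun f hf hfc => ?_⟩
  have : SFinite (toMeasure f) := by unfold toMeasure; infer_instance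
  refine hasLocalSolution_of_supersolution (w := fun z => ENNReal.ofReal (A * profile θ β z.1 z.2))
    (by linarith) (fun x t _ => ENNReal.ofReal_lt_top) fun x t ht => ?_
  have hP : 0 ≤ profile θ β x t := profile_nonneg
  have hlin : ∫⁻ y, ENNReal.ofReal (G N θ (x - y) t) ∂(toMeasure f) ≤
      ENNReal.ofReal (A / (2 * C₁)) * ENNReal.ofReal (C₁ * profile θ β x t) := by
    have hGm : Measurable fun y => ENNReal.ofReal (G N θ (x - y) t) :=
      ((isRadialSubprob_G hN hθ hθ2 ht).measurable.comp
        (measurable_const.sub measurable_id)).ennreal_ofReal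
    rw [toMeasure, lintegral_withDensity_eq_lintegral_mul₀ hf.ennreal_ofReal hGm.aemeasurable]
    calc ∫⁻ y, ((fun y => ENNReal.ofReal (f y)) * fun y => ENNReal.ofReal (G N θ (x - y) t)) y
        ≤ ∫⁻ y, ENNReal.ofReal (A / (2 * C₁)) *
          (ENNReal.ofReal (G N θ (x - y) t) * ENNReal.ofReal (‖y‖ ^ (-β))) := by
          refine lintegral_mono_ae ?_
          filter_upwards [hfc] with y hy
          rw [Pi.mul_apply, mul_comm (ENNReal.ofReal (f y)), mul_left_comm,
            ← ENNReal.ofReal_mul (show 0 ≤ A / (2 * C₁) by positivity)]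
          gcongr
      _ ≤ _ := by
          rw [lintegral_const_mul' _ _ ENNReal.ofReal_ne_top]
          gcongr
          exact h1 t x ht
  have hduh : ∫⁻ s in Ioo 0 t, ∫⁻ y, ENNReal.ofReal (G N θ (x - y) (t - s)) *
      ENNReal.ofReal (‖y‖ ^ (-γ)) * ENNReal.ofReal (A * profile θ β y s) ^ p ≤
        ENNReal.ofReal (A ^ p) * ENNReal.ofReal (C₂ * profile θ β x t) := by
    have e : ∀ s y, ENNReal.ofReal (G N θ (x - y) (t - s)) * ENNReal.ofReal (‖y‖ ^ (-γ)) *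
        ENNReal.ofReal (A * profile θ β y s) ^ p = ENNReal.ofReal (A ^ p) *
        (ENNReal.ofReal (G N θ (x - y) (t - s)) * ENNReal.ofReal (‖y‖ ^ (-γ)) *
          ENNReal.ofReal (profile θ β y s) ^ p) := fun s y => by
      rw [ENNReal.ofReal_mul hA.le, ENNReal.mul_rpow_of_nonneg _ _ (by linarith),
        ENNReal.ofReal_rpow_of_nonneg hA.le (by linarith)]
      ring
    simp only [e, lintegral_const_mul' _ _ ENNReal.ofReal_ne_top]
    gcongr
    exact h2 t x ht
  refine (add_le_add hlin hduh).trans ?_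
  rw [← ENNReal.ofReal_mul (by positivity), ← ENNReal.ofReal_mul (by positivity),
    ← ENNReal.ofReal_add (by positivity) (by positivity)]
  refine ENNReal.ofReal_le_ofReal (le_of_eq ?_)
  rw [← mul_assoc, ← mul_assoc, hAp]
  field_simp
  ring

end HardyParabolic

theorem corollary1p1 (N : ℕ) (hN : 1 ≤ N) (θ γ p : ℝ)
    (hθ0 : 0 < θ) (hθ2 : θ ≤ 2) (hγ0 : 0 < γ) (hγ : γ < min θ (N : ℝ))
    (hγp : θ < 2 → γ < θ * (p - 1))
    (hp : HardyParabolic.pCrit N θ γ < p) :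
    (∃ c : ℝ, 0 < c ∧
      ∀ f : EuclideanSpace ℝ (Fin N) → ℝ, AEMeasurable f volume →
        (∀ᵐ x, 0 ≤ f x ∧ f x ≤ c * ‖x‖ ^ (-((θ - γ) / (p - 1)))) →
        HardyParabolic.HasLocalSolution N θ γ p (HardyParabolic.toMeasure f)) ∧
    (∃ C : ℝ, 0 < C ∧
      ∀ f : EuclideanSpace ℝ (Fin N) → ℝ, AEMeasurable f volume →
        (∀ᵐ x, 0 ≤ f x) →
        (∃ δ : ℝ, 0 < δ ∧
          ∀ᵐ x, ‖x‖ < δ → C * ‖x‖ ^ (-((θ - γ) / (p - 1))) ≤ f x) →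
        ¬ HardyParabolic.HasLocalSolution N θ γ p (HardyParabolic.toMeasure f)) := by
  obtain ⟨hγθ, hγN⟩ := lt_min_iff.mp hγ
  have hN0 : (0 : ℝ) < N := by exact_mod_cast hN
  have hcrit : (θ - γ) / N < p - 1 := by
    unfold HardyParabolic.pCrit at hp
    linarith
  have hp1 : 0 < p - 1 := (div_pos (by linarith) hN0).trans hcrit
  set β := (θ - γ) / (p - 1) with hβ_def
  have hβ : 0 < β := div_pos (by linarith) hp1
  have hβN : β < N := by
    rw [div_lt_iff₀ hN0] at hcrit
    rw [hβ_def, div_lt_iff₀ hp1]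
    linarith
  have hscale : θ - γ - β * p = -β := by
    have : β * (p - 1) = θ - γ := div_mul_cancel₀ _ hp1.ne'
    linarith
  constructor
  · obtain ⟨c, hc, h⟩ := HardyParabolic.exists_hasLocalSolution hN hθ0 hθ2 hγ0 (by linarith) hγθ
      hγN hβ.le hβN hscale
    exact ⟨c, hc, fun f hf hfc => h f hf (hfc.mono fun x hx => hx.2)⟩
  · obtain ⟨C, hC, h⟩ := HardyParabolic.exists_not_hasLocalSolution (N := N) hN hθ0 hγ0
      (by linarith) hβ.le hscale
    exact ⟨C, hC, fun f hf _ hfC => h f hf hfC⟩
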